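/- Let $h_1,h_2,h_3=h_S$ be three $SU(2)$ doublets with values in $\mathbb C^2$, let $h_a^\dagger h_b$ denote the standard Hermitian product of $h_a$ and $h_b$, and consider the $S_3$-symmetric potential $V=V_2+V_4$ with $$V_2=\mu_0^2\,h_S^\dagger h_S+\mu_1^2(h_1^\dagger h_1+h_2^\dagger h_2),$$ $$\begin{aligned}V_4=&\ \lambda_1(h_1^\dagger h_1+h_2^\dagger h_2)^2+\lambda_2(h_1^\dagger h_2-h_2^\dagger h_1)^2+\lambda_3\big[(h_1^\dagger h_1-h_2^\dagger h_2)^2+(h_1^\dagger h_2+h_2^\dagger h_1)^2\big]\\&+\big\{\lambda_4\big[(h_S^\dagger h_1)(h_1^\dagger h_2+h_2^\dagger h_1)+(h_S^\dagger h_2)(h_1^\dagger h_1-h_2^\dagger h_2)\big]+\mathrm{h.c.}\big\}\\&+\lambda_5(h_S^\dagger h_S)(h_1^\dagger h_1+h_2^\dagger h_2)+\lambda_6\big[(h_S^\dagger h_1)(h_1^\dagger h_S)+(h_S^\dagger h_2)(h_2^\dagger h_S)\big]\\&+\big\{\lambda_7\big[(h_S^\dagger h_1)^2+(h_S^\dagger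 h_2)^2\big]+\mathrm{h.c.}\big\}+\lambda_8(h_S^\dagger h_S)^2,\end{aligned}$$ where $\lambda_4,\lambda_7\in\mathbb C$ and $\mu_0^2,\mu_1^2$ and the other $\lambda_i$ are real. Write $\lambda_4=\lambda_4^{\mathrm R}+i\lambda_4^{\mathrm I}$. Write $V_2=Y_{ab}(h_a^\dagger h_b)$ and $V_4=\tfrac12Z_{abcd}(h_a^\dagger h_b)(h_c^\dagger h_d)$, where repeated indices are summed from $1$ to $3$ and $Z_{abcd}=Z_{cdab}$. For arbitrary complex tensors $Y$, $Z$ put $$\begin{aligned} I_{5Z}^{(1)}&=\mathrm{Im}\,[Z_{aabc}Z_{dbef}Z_{cghe}Z_{idgh}Z_{fijj}],\\ I_{5Z}^{(2)}&=\mathrm{Im}\,[Z_{abbc}Z_{daef}Z_{cghe}Z_{idgh}Z_{fjji}],\\ I_{6Z}^{(1)}&=\mathrm{Im}\,[Z_{abcd}Z_{baef}Z_{gchi}Z_{djke}Z_{fkil}Z_{jglh}],\\ I_{6Z}^{(2)}&=\mathrm{Im}\,[Z_{abcd}Z_{baef}Z_{gchi}Z_{dejk}Z_{fhkl}Z_{lgij}],\\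 I_{7Z}&=\mathrm{Im}\,[Z_{abcd}Z_{eafc}Z_{bgdh}Z_{iejk}Z_{gflm}Z_{hlkn}Z_{minj}],\\ I_{2Y3Z}&=\mathrm{Im}\,[Z_{abcd}Z_{befg}Z_{dchf}Y_{ga}Y_{eh}]. \end{aligned}$$ A basis change is $h_a=U_{ab}h'_b$ with $U\in U(3)$; it replaces $Y_{ab}$ by $\overline{U_{pa}}U_{qb}Y_{pq}$ and $Z_{abcd}$ by $\overline{U_{pa}}U_{qb}\overline{U_{rc}}U_{sd}Z_{pqrs}$. A potential $W$ ($W=V_4$ or $W=V$) *explicitly conserves CP* if it is invariant under some general CP transformation $h_a\mapsto X_{ab}h_b^*$ with $X\in U(3)$. **Theorem.** (a) The six quantities, as functions of arbitrary complex tensors $Y,Z$, are unchanged by every basis change, and change sign under complex conjugation of $Y$ and $Z$ (they are CP-odd basis invariants). (b) $V_4$ explicitly conserves CP if and only if $I_{5Z}^{(1)}=I_{5Z}^{(2)}=I_{6Z}^{(1)}=I_{6Z}^{(2)}=I_{7Z}=0$; and also if and only if there is a basis in which all components of $Z$ are real. (c) $V=V_2+V_4$ explicitly conserves CP if and only if $I_{5Z}^{(1)}=I_{5Z}^{(2)}=I_{6Z}^{(1)}=I_{6Z}^{(2)}=I_{7Z}=I_{2Y3Z}=0$;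 and also if and only if there is a basis in which all components of both $Y$ and $Z$ are real. (d) Suppose $\lambda_7$ is real. Then $V_4$ explicitly conserves CP if and only if at least one of the following holds: $\lambda_4^{\mathrm I}=0$ (Solution 0); $\lambda_4^{\mathrm R}=0$ (Solution 1); $\lambda_7=0$ (Solution 2); or (Solution 3) $\lambda_4^{\mathrm R}\lambda_4^{\mathrm I}\lambda_7\neq0$ and, with $\lambda_{23}=\lambda_2+\lambda_3$, $$(\lambda_4^{\mathrm R})^2=-\frac{(\lambda_{23}-\lambda_7)(2\lambda_{23}+\lambda_7)^2}{\lambda_7},\qquad(\lambda_4^{\mathrm I})^2=\frac{(\lambda_{23}+\lambda_7)(2\lambda_{23}-\lambda_7)^2}{\lambda_7},$$ $$\lambda_5=2(\lambda_1+\lambda_2),\qquad\lambda_6=4\lambda_3,\qquad\lambda_8=\lambda_1-\lambda_2.$$ The full potential $V$ explicitly conserves CP if and only if Solution 0, 1 or 2 holds, or Solution 3 holds together with $\mu_0^2=\mu_1^2$. -/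

import Mathlib

/-! The `S_3`-symmetric three-Higgs-doublet potential, its `Y`- and `Z`-tensors, basis changes,
explicit CP conservation, and CP-odd invariants.  The doublets `h_1`, `h_2`, `h_S` carry the
flavour indices `0`, `1`, `2 : Fin 3`. -/

namespace S3HDM

/-- Parameters of the potential. `mu0sq` and `mu1sq` stand for the real bilinear couplings
`μ₀²` and `μ₁²` (of either sign); `l4` and `l7` may be complex, all other couplings are real. -/
structure Couplings where
  mu0sq : ℝ
  mu1sq : ℝ
  l1 : ℝ
  l2 : ℝ
  l3 : ℝ
  l4 : ℂ
  l5 : ℝ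
  l6 : ℝ
  l7 : ℂ
  l8 : ℝ

/-- Values of three `SU(2)` doublets: `h a i` is the `i`-th component of the doublet `h_a`. -/
abbrev Doublets : Type := Fin 3 → Fin 2 → ℂ

/-- The bilinear `h_a† h_b`. -/
def bil (h : Doublets) (a b : Fin 3) : ℂ := ∑ i, star (h a i) * h b i

/-- Adding the hermitian conjugate. -/
def addHC (z : ℂ) : ℂ := z + star z

/-- The bilinear part of the potential. -/
def V2 (p : Couplings) (h : Doublets) : ℂ :=
  p.mu0sq * bil h 2 2 + p.mu1sq * (bil h 0 0 + bil h 1 1)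

/-- The quadrilinear part of the potential. -/
def V4 (p : Couplings) (h : Doublets) : ℂ :=
  p.l1 * (bil h 0 0 + bil h 1 1) ^ 2
    + p.l2 * (bil h 0 1 - bil h 1 0) ^ 2
    + p.l3 * ((bil h 0 0 - bil h 1 1) ^ 2 + (bil h 0 1 + bil h 1 0) ^ 2)
    + addHC (p.l4 * (bil h 2 0 * (bil h 0 1 + bil h 1 0)
        + bil h 2 1 * (bil h 0 0 - bil h 1 1)))
    + p.l5 * bil h 2 2 * (bil h 0 0 + bil h 1 1)
    + p.l6 * (bil h 2 0 * bil h 0 2 + bil h 2 1 * bil h 1 2)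
    + addHC (p.l7 * (bil h 2 0 * bil h 2 0 + bil h 2 1 * bil h 2 1))
    + p.l8 * bil h 2 2 ^ 2

/-- The full potential. -/
def V (p : Couplings) (h : Doublets) : ℂ := V2 p h + V4 p h

/-- The general CP transformation `h_a ↦ ∑_b X_ab h_b^*`. -/
def cpTransform (X : Matrix (Fin 3) (Fin 3) ℂ) (h : Doublets) : Doublets :=
  fun a i => ∑ b, X a b * star (h b i)

/-- A potential explicitly conserves CP if it is invariant under some general CP transformation,
with a unitary matrix mixing the three doublets. -/
def ExplicitlyConservesCP (W : Doublets → ℂ) : Prop :=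
  ∃ X ∈ Matrix.unitaryGroup (Fin 3) ℂ, ∀ h, W (cpTransform X h) = W h

/-- Two-index coupling tensors `Y_ab`. -/
abbrev Tensor2 : Type := Fin 3 → Fin 3 → ℂ

/-- Four-index coupling tensors `Z_abcd`. -/
abbrev Tensor4 : Type := Fin 3 → Fin 3 → Fin 3 → Fin 3 → ℂ

/-- The `Y`-tensor of the potential. -/
def tensorY (p : Couplings) : Tensor2 :=
  !![(p.mu1sq : ℂ), 0, 0; 0, p.mu1sq, 0; 0, 0, p.mu0sq]

/-- The `Z`-tensor of the potential: the entry `Z_abcd` is the `(c, d)` entry of the matrix in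
row `a` and column `b` of the array. -/
def tensorZ (p : Couplings) : Tensor4 :=
  let blocks : Fin 3 → Fin 3 → Matrix (Fin 3) (Fin 3) ℂ := ![
    ![!![2 * p.l1 + 2 * p.l3, 0, 0; 0, 2 * p.l1 - 2 * p.l3, star p.l4; 0, p.l4, p.l5],
      !![0, 2 * p.l2 + 2 * p.l3, star p.l4; -2 * p.l2 + 2 * p.l3, 0, 0; p.l4, 0, 0],
      !![0, star p.l4, 2 * star p.l7; star p.l4, 0, 0; p.l6, 0, 0]],
    ![!![0, -2 * p.l2 + 2 * p.l3, star p.l4; 2 * p.l2 + 2 * p.l3, 0, 0; p.l4, 0, 0],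
      !![2 * p.l1 - 2 * p.l3, 0, 0; 0, 2 * p.l1 + 2 * p.l3, -star p.l4; 0, -p.l4, p.l5],
      !![star p.l4, 0, 0; 0, -star p.l4, 2 * star p.l7; 0, p.l6, 0]],
    ![!![0, p.l4, p.l6; p.l4, 0, 0; 2 * p.l7, 0, 0],
      !![p.l4, 0, 0; 0, -p.l4, p.l6; 0, 2 * p.l7, 0],
      !![p.l5, 0, 0; 0, p.l5, 0; 0, 0, 2 * p.l8]]]
  fun a b c d => blocks a b c d

theorem V2_eq_tensorY (p : Couplings) (h : Doublets) :
    V2 p h = ∑ a, ∑ b, tensorY p a b * bil h a b := by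
  simp [V2, Fin.sum_univ_three, tensorY]
  ring

theorem star_bil (h : Doublets) (a b : Fin 3) : star (bil h a b) = bil h b a := by
  simp [bil, mul_comm]

theorem V4_eq_tensorZ (p : Couplings) (h : Doublets) :
    V4 p h = (1 / 2) * ∑ a, ∑ b, ∑ c, ∑ d, tensorZ p a b c d * bil h a b * bil h c d := by
  simp only [V4, addHC, star_mul, star_add, star_sub, star_bil]
  generalize bil h = K
  simp only [Fin.sum_univ_three, tensorZ, Fin.isValue,
    Matrix.of_apply, Matrix.cons_val_zero, Matrix.cons_val_one, Matrix.cons_val, zero_mul,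
    add_zero, zero_add]
  generalize star p.l4 = c4
  generalize star p.l7 = c7
  ring

/-- The `Y`-tensor in the new basis `h'` with `h_a = ∑_b U_ab h'_b`. -/
def changeY (U : Matrix (Fin 3) (Fin 3) ℂ) (Y : Tensor2) : Tensor2 :=
  fun a b => ∑ p, ∑ q, star (U p a) * U q b * Y p q

/-- The `Z`-tensor in the new basis `h'` with `h_a = ∑_b U_ab h'_b`. -/
def changeZ (U : Matrix (Fin 3) (Fin 3) ℂ) (Z : Tensor4) : Tensor4 :=
  fun a b c d => ∑ p, ∑ q, ∑ r, ∑ s,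
    star (U p a) * U q b * star (U r c) * U s d * Z p q r s

/-- There is a basis of doublets in which all quartic couplings are real. -/
def HasRealBasisZ (Z : Tensor4) : Prop :=
  ∃ U ∈ Matrix.unitaryGroup (Fin 3) ℂ, ∀ a b c d, (changeZ U Z a b c d).im = 0

/-- There is a basis of doublets in which all bilinear and quartic couplings are real. -/
def HasRealBasisYZ (Y : Tensor2) (Z : Tensor4) : Prop :=
  ∃ U ∈ Matrix.unitaryGroup (Fin 3) ℂ,
    (∀ a b, (changeY U Y a b).im = 0) ∧ ∀ a b c d, (changeZ U Z a b c d).im = 0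

/-- The invariant `I_{5Z}^{(1)}`. -/
def I5Z1 (Z : Tensor4) : ℝ :=
  (∑ a, ∑ b, ∑ c, ∑ d, ∑ e, ∑ f, ∑ g, ∑ h, ∑ i, ∑ j,
    Z a a b c * Z d b e f * Z c g h e * Z i d g h * Z f i j j).im

/-- The invariant `I_{5Z}^{(2)}`. -/
def I5Z2 (Z : Tensor4) : ℝ :=
  (∑ a, ∑ b, ∑ c, ∑ d, ∑ e, ∑ f, ∑ g, ∑ h, ∑ i, ∑ j,
    Z a b b c * Z d a e f * Z c g h e * Z i d g h * Z f j j i).im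

/-- The invariant `I_{6Z}^{(1)}`. -/
def I6Z1 (Z : Tensor4) : ℝ :=
  (∑ a, ∑ b, ∑ c, ∑ d, ∑ e, ∑ f, ∑ g, ∑ h, ∑ i, ∑ j, ∑ k, ∑ l,
    Z a b c d * Z b a e f * Z g c h i * Z d j k e * Z f k i l * Z j g l h).im

/-- The invariant `I_{6Z}^{(2)}`. -/
def I6Z2 (Z : Tensor4) : ℝ :=
  (∑ a, ∑ b, ∑ c, ∑ d, ∑ e, ∑ f, ∑ g, ∑ h, ∑ i, ∑ j, ∑ k, ∑ l,
    Z a b c d * Z b a e f * Z g c h i * Z d e j k * Z f h k l * Z l g i j).im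

/-- The invariant `I_{7Z}`. -/
def I7Z (Z : Tensor4) : ℝ :=
  (∑ a, ∑ b, ∑ c, ∑ d, ∑ e, ∑ f, ∑ g, ∑ h, ∑ i, ∑ j, ∑ k, ∑ l, ∑ m, ∑ n,
    Z a b c d * Z e a f c * Z b g d h * Z i e j k * Z g f l m * Z h l k n * Z m i n j).im

/-- The invariant `I_{2Y3Z}`. -/
def I2Y3Z (Y : Tensor2) (Z : Tensor4) : ℝ :=
  (∑ a, ∑ b, ∑ c, ∑ d, ∑ e, ∑ f, ∑ g, ∑ h,
    Z a b c d * Z b e f g * Z d c h f * Y g a * Y e h).im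

/-- The six quantities together, the five pure-`Z` ones first. -/
def invariants (Y : Tensor2) (Z : Tensor4) : Fin 6 → ℝ :=
  ![I5Z1 Z, I5Z2 Z, I6Z1 Z, I6Z2 Z, I7Z Z, I2Y3Z Y Z]

/-- The relations among the quartic couplings that define Solution 3
(for real `λ₇ = p.l7.re`, with `λ₂₃ = λ₂ + λ₃`). -/
def Solution3 (p : Couplings) : Prop :=
  p.l4.re * p.l4.im * p.l7.re ≠ 0 ∧
  p.l4.re ^ 2 = -((p.l2 + p.l3 - p.l7.re) * (2 * (p.l2 + p.l3) + p.l7.re) ^ 2) / p.l7.re ∧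
  p.l4.im ^ 2 = (p.l2 + p.l3 + p.l7.re) * (2 * (p.l2 + p.l3) - p.l7.re) ^ 2 / p.l7.re ∧
  p.l5 = 2 * (p.l1 + p.l2) ∧
  p.l6 = 4 * p.l3 ∧
  p.l8 = p.l1 - p.l2

end S3HDM

/-! Each quantity is a closed graph of tensors in which every line joins a conjugated (first or
third) index to an unconjugated (second or fourth) one, so unitary factors cancel line by line;
conjugating the tensors conjugates the contraction (`contract_changeZ`, `contract_star`). A
potential determines its symmetric tensor (`quartic_injective`), and the tensors of `V` are
hermitian, so CP invariance under `X` says that the basis change `X` conjugates the tensors. The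
invariants then equal their own negatives and vanish. Conversely, a real basis `U` yields the CP
transformation `X = U Uᵀ`. What remains is to pass from vanishing invariants to a real basis.

A rephasing of `h_S` makes `λ₇` real. In the basis diagonalizing the order-three symmetry
(`chargedZ`), `λ₄` enters only through `y = -√2 λ₄` and its conjugate, and every invariant becomes a
real polynomial times `λ₇ Im(y²)`, where `Im(y²) = 4 λ₄ᴿ λ₄ᴵ`. Unless Solution 0, 1 or 2 holds, this
factor cancels. The two degree-five invariants then give two linear relations, leaving one parameter
`u`; the degree-six and degree-seven ones force `u = 0` and fix `(λ₄ᴿ)²` and `(λ₄ᴵ)²`, which is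
Solution 3 (`solve_invariant_equations`). The mixed invariant is proportional to `(μ₀² - μ₁²)²`.

Solutions 0, 1 and 2 become real after a rephasing of `h_S`. For Solution 3 a suitable rephasing
makes the charged tensor symmetric under cyclic permutation of the three doublets, and a circulant
unitary matrix then makes it real (`realBasis_of_solution3`). For equal masses `Y` is scalar, so
that basis also serves the full potential. -/

namespace S3HDM

open Finset

/-! ### Complete contractions of quartic tensors -/

/-- The complete contraction of quartic tensors along a graph: the slot `(k, 0)` (resp. `(k, 1)`)
of the `k`-th tensor has its first (third) index on the line `α (k, 0)` (`α (k, 1)`) and its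
second (fourth) index on the line `β (k, 0)` (`β (k, 1)`). -/
def contract {v E : Type*} [Fintype v] [Fintype E] [DecidableEq E]
    (α β : v × Fin 2 → E) (Z : v → Tensor4) : ℂ :=
  ∑ x : E → Fin 3, ∏ k, Z k (x (α (k, 0))) (x (β (k, 0))) (x (α (k, 1))) (x (β (k, 1)))

/-- Collecting the conjugated labels in `y` and the others in `w` separates the factors `star U`
from the factors `U`, as redistribution along lines requires. -/
theorem changeZ_eq_sum_fun (U : Matrix (Fin 3) (Fin 3) ℂ) (Z : Tensor4) (a b c d : Fin 3) :
    changeZ U Z a b c d = ∑ y : Fin 2 → Fin 3, ∑ w : Fin 2 → Fin 3,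
      (star (U (y 0) a) * star (U (y 1) c)) * (U (w 0) b * U (w 1) d) *
        Z (y 0) (w 0) (y 1) (w 1) := by
  simp only [← (finTwoArrowEquiv (Fin 3)).symm.sum_comp, Fintype.sum_prod_type,
    finTwoArrowEquiv_symm_apply, Matrix.cons_val_zero, Matrix.cons_val_one, changeZ]
  refine sum_congr rfl fun p _ => ?_
  rw [sum_comm]
  exact sum_congr rfl fun r _ => sum_congr rfl fun q _ => sum_congr rfl fun s _ => by ring

theorem sum_star_mul_of_mem_unitaryGroup {U : Matrix (Fin 3) (Fin 3) ℂ}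
    (hU : U ∈ Matrix.unitaryGroup (Fin 3) ℂ) (a b : Fin 3) :
    ∑ c, star (U a c) * U b c = if b = a then 1 else 0 := by
  have h := congrFun (congrFun (Matrix.mem_unitaryGroup_iff.1 hU) b) a
  simpa [Matrix.mul_apply, Matrix.one_apply, mul_comm] using h

/-- Bijectivity of `α` and `β` means that each line carries exactly one factor `star U` and one
factor `U`. Summing over the label of the line gives a Kronecker delta by unitarity, which
identifies the two new labels at its ends. -/
theorem contract_changeZ {v E : Type*} [Fintype v] [DecidableEq v] [Fintype E] [DecidableEq E]
    {α β : v × Fin 2 → E} (hα : Function.Bijective α) (hβ : Function.Bijective β)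
    {U : Matrix (Fin 3) (Fin 3) ℂ} (hU : U ∈ Matrix.unitaryGroup (Fin 3) ℂ) (Z : v → Tensor4) :
    contract α β (fun k => changeZ U (Z k)) = contract α β Z := by
  classical
  let eα := Equiv.ofBijective α hα
  let eβ := Equiv.ofBijective β hβ
  have slots : ∀ f : v × Fin 2 → ℂ, ∏ k, f (k, 0) * f (k, 1) = ∏ s, f s := fun f => by
    rw [Fintype.prod_prod_type]; simp [Fin.prod_univ_two]
  have expand : ∀ x : E → Fin 3,
      ∏ k, changeZ U (Z k) (x (α (k, 0))) (x (β (k, 0))) (x (α (k, 1))) (x (β (k, 1))) =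
      ∑ y : E → Fin 3, ∑ w : E → Fin 3, (∏ e, star (U (y e) (x e)) * U (w e) (x e)) *
        ∏ k, Z k (y (α (k, 0))) (w (β (k, 0))) (y (α (k, 1))) (w (β (k, 1))) := by
    intro x
    simp only [changeZ_eq_sum_fun]
    simp only [← Fintype.sum_prod_type']
    rw [prod_univ_sum, Fintype.piFinset_univ]
    symm
    -- Independent choices of summation labels at every tensor amount to two labellings `y`, `w` of
    -- the lines, transported through `α` and `β`.
    refine Fintype.sum_equiv
      (((eα.arrowCongr (Equiv.refl (Fin 3))).symm.prodCongr
        (eβ.arrowCongr (Equiv.refl (Fin 3))).symm).trans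
        (((Equiv.curry v (Fin 2) (Fin 3)).prodCongr (Equiv.curry v (Fin 2) (Fin 3))).trans
          (Equiv.arrowProdEquivProdArrow v (fun _ => Fin 2 → Fin 3)
            (fun _ => Fin 2 → Fin 3)).symm)) _ _ ?_
    rintro ⟨y, w⟩
    simp only [prod_mul_distrib]
    rw [← eα.prod_comp (fun e => star (U (y e) (x e))), ← eβ.prod_comp (fun e => U (w e) (x e)),
      ← slots, ← slots]
    simp only [prod_mul_distrib]
    rfl
  unfold contract
  simp only [expand]
  rw [sum_comm]
  refine sum_congr rfl fun y _ => ?_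
  rw [sum_comm]
  simp only [← sum_mul]
  have delta : ∀ w : E → Fin 3,
      ∑ x : E → Fin 3, ∏ e, star (U (y e) (x e)) * U (w e) (x e) = if w = y then 1 else 0 := by
    intro w
    have h := prod_univ_sum (fun _ : E => (univ : Finset (Fin 3)))
      (fun e c => star (U (y e) c) * U (w e) c)
    rw [Fintype.piFinset_univ] at h
    rw [← h]
    simp only [sum_star_mul_of_mem_unitaryGroup hU]
    rw [prod_ite_zero]
    simp [funext_iff]
  simp only [delta, ite_mul, one_mul, zero_mul, sum_ite_eq', mem_univ, if_true]

theorem sum_vecCons {n : ℕ} {κ : Type*} [Fintype κ] {M : Type*} [AddCommMonoid M]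
    (F : (Fin (n + 1) → κ) → M) :
    ∑ x, F x = ∑ a, ∑ x : Fin n → κ, F (Matrix.vecCons a x) := by
  rw [← (Fin.consEquiv (fun _ : Fin (n + 1) => κ)).sum_comp, Fintype.sum_prod_type]
  rfl

/-- The letters are numbered alphabetically from `0`; for each factor the first table lists its
first and third letters, the second table its second and fourth. -/
theorem I5Z1_eq_contract (Z : Tensor4) :
    I5Z1 Z = (contract (E := Fin 10)
      (fun s : Fin 5 × Fin 2 => ![![0, 1], ![3, 4], ![2, 7], ![8, 6], ![5, 9]] s.1 s.2)
      (fun s => ![![0, 2], ![1, 5], ![6, 4], ![3, 7], ![8, 9]] s.1 s.2)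
      (fun _ => Z)).im := by
  refine congrArg Complex.im ?_
  unfold contract
  iterate 10 rw [sum_vecCons]; refine sum_congr rfl fun _ _ => ?_
  rw [Fintype.sum_subsingleton _ ![], Fin.prod_univ_five]
  rfl

theorem I5Z2_eq_contract (Z : Tensor4) :
    I5Z2 Z = (contract (E := Fin 10)
      (fun s : Fin 5 × Fin 2 => ![![0, 1], ![3, 4], ![2, 7], ![8, 6], ![5, 9]] s.1 s.2)
      (fun s => ![![1, 2], ![0, 5], ![6, 4], ![3, 7], ![9, 8]] s.1 s.2)
      (fun _ => Z)).im := by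
  refine congrArg Complex.im ?_
  unfold contract
  iterate 10 rw [sum_vecCons]; refine sum_congr rfl fun _ _ => ?_
  rw [Fintype.sum_subsingleton _ ![], Fin.prod_univ_five]
  rfl

theorem I6Z1_eq_contract (Z : Tensor4) :
    I6Z1 Z = (contract (E := Fin 12)
      (fun s : Fin 6 × Fin 2 => ![![0, 2], ![1, 4], ![6, 7], ![3, 10], ![5, 8], ![9, 11]] s.1 s.2)
      (fun s => ![![1, 3], ![0, 5], ![2, 8], ![9, 4], ![10, 11], ![6, 7]] s.1 s.2)
      (fun _ => Z)).im := by
  refine congrArg Complex.im ?_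
  unfold contract
  iterate 12 rw [sum_vecCons]; refine sum_congr rfl fun _ _ => ?_
  rw [Fintype.sum_subsingleton _ ![], Fin.prod_univ_six]
  rfl

theorem I6Z2_eq_contract (Z : Tensor4) :
    I6Z2 Z = (contract (E := Fin 12)
      (fun s : Fin 6 × Fin 2 => ![![0, 2], ![1, 4], ![6, 7], ![3, 9], ![5, 10], ![11, 8]] s.1 s.2)
      (fun s => ![![1, 3], ![0, 5], ![2, 8], ![4, 10], ![7, 11], ![6, 9]] s.1 s.2)
      (fun _ => Z)).im := by
  refine congrArg Complex.im ?_
  unfold contract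
  iterate 12 rw [sum_vecCons]; refine sum_congr rfl fun _ _ => ?_
  rw [Fintype.sum_subsingleton _ ![], Fin.prod_univ_six]
  rfl

theorem I7Z_eq_contract (Z : Tensor4) :
    I7Z Z = (contract (E := Fin 14)
      (fun s : Fin 7 × Fin 2 => ![![0, 2], ![4, 5], ![1, 3], ![8, 9], ![6, 11], ![7, 10], ![12, 13]] s.1 s.2)
      (fun s => ![![1, 3], ![0, 2], ![6, 7], ![4, 10], ![5, 12], ![11, 13], ![8, 9]] s.1 s.2)
      (fun _ => Z)).im := by
  refine congrArg Complex.im ?_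
  unfold contract
  iterate 14 rw [sum_vecCons]; refine sum_congr rfl fun _ _ => ?_
  rw [Fintype.sum_subsingleton _ ![], Fin.prod_univ_seven]
  rfl

/-! ### Evaluation of the invariants by successive partial contractions -/

/-- The quartic tensor of the potential in the basis `h₊, h₋, h_S` which diagonalizes the
order-three symmetry: the flavour charge `(1, 2, 0)` modulo `3` is conserved. -/
def chargedZ (a b c d e f g g' y y' : ℂ) : Tensor4 :=
  let blocks : Fin 3 → Fin 3 → Matrix (Fin 3) (Fin 3) ℂ := ![
    ![!![a, 0, 0; 0, b, 0; 0, 0, d], !![0, 0, y'; c, 0, 0; 0, y, 0],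
      !![0, y', 0; 0, 0, g'; e, 0, 0]],
    ![!![0, c, 0; 0, 0, y'; y, 0, 0], !![b, 0, 0; 0, a, 0; 0, 0, d],
      !![0, 0, g'; y', 0, 0; 0, e, 0]],
    ![!![0, 0, e; y, 0, 0; 0, g, 0], !![0, y, 0; 0, 0, e; g, 0, 0],
      !![d, 0, 0; 0, d, 0; 0, 0, f]]]
  fun i j k l => blocks i j k l

/-- The graph of each pure-`Z` invariant is cut into two pieces joined by four lines. Summing the
inner indices first keeps the explicit evaluations small enough for `ring`. -/
def ladder (Z : Tensor4) (c e i d : Fin 3) : ℂ := ∑ g, ∑ h, Z c g h e * Z i d g h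

def outerDressed (Z : Tensor4) (c e i d : Fin 3) : ℂ :=
  ∑ b, ∑ f, (∑ a, Z a a b c) * Z d b e f * ∑ j, Z f i j j

def innerDressed (Z : Tensor4) (c e i d : Fin 3) : ℂ :=
  ∑ a, ∑ f, (∑ b, Z a b b c) * Z d a e f * ∑ j, Z f j j i

def value5Z1 (Z : Tensor4) : ℂ := ∑ c, ∑ e, ∑ i, ∑ d, ladder Z c e i d * outerDressed Z c e i d

def value5Z2 (Z : Tensor4) : ℂ := ∑ c, ∑ e, ∑ i, ∑ d, ladder Z c e i d * innerDressed Z c e i d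

def bubble (Z : Tensor4) (c d e f : Fin 3) : ℂ := ∑ a, ∑ b, Z a b c d * Z b a e f

def left6Z1 (Z : Tensor4) (c f j k : Fin 3) : ℂ := ∑ d, ∑ e, bubble Z c d e f * Z d j k e

def right6Z1 (Z : Tensor4) (c f j k : Fin 3) : ℂ :=
  ∑ i, ∑ l, (∑ g, ∑ h, Z g c h i * Z j g l h) * Z f k i l

def value6Z1 (Z : Tensor4) : ℂ := ∑ c, ∑ f, ∑ j, ∑ k, left6Z1 Z c f j k * right6Z1 Z c f j k

def left6Z2 (Z : Tensor4) (c f j k : Fin 3) : ℂ := ∑ d, ∑ e, bubble Z c d e f * Z d e j k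

def right6Z2 (Z : Tensor4) (c f j k : Fin 3) : ℂ :=
  ∑ h, ∑ l, (∑ g, ∑ i, Z g c h i * Z l g i j) * Z f h k l

def value6Z2 (Z : Tensor4) : ℂ := ∑ c, ∑ f, ∑ j, ∑ k, left6Z2 Z c f j k * right6Z2 Z c f j k

def left7Z (Z : Tensor4) (e f g h : Fin 3) : ℂ :=
  ∑ b, ∑ d, (∑ a, ∑ c, Z a b c d * Z e a f c) * Z b g d h

def cross7Z (Z : Tensor4) (e h l m : Fin 3) : ℂ :=
  ∑ k, ∑ n, Z h l k n * ∑ i, ∑ j, Z i e j k * Z m i n j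

def right7Z (Z : Tensor4) (e f g h : Fin 3) : ℂ := ∑ l, ∑ m, Z g f l m * cross7Z Z e h l m

def value7Z (Z : Tensor4) : ℂ := ∑ e, ∑ f, ∑ g, ∑ h, left7Z Z e f g h * right7Z Z e f g h

theorem ladder_eq_sum (Z : Tensor4) (c e i d : Fin 3) : ladder Z c e i d =
    ∑ p : Fin 3 × Fin 3,
      Z c p.1 p.2 e * Z i d p.1 p.2 := by
  simp only [ladder, Fintype.sum_prod_type]

theorem outerDressed_eq_sum (Z : Tensor4) (c e i d : Fin 3) : outerDressed Z c e i d =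
    ∑ p : Fin 3 × Fin 3 × Fin 3 × Fin 3,
      Z p.2.2.2 p.2.2.2 p.1 c * Z d p.1 e p.2.1 * Z p.2.1 i p.2.2.1 p.2.2.1 := by
  simp only [outerDressed, sum_mul, mul_sum, Fintype.sum_prod_type]

theorem innerDressed_eq_sum (Z : Tensor4) (c e i d : Fin 3) : innerDressed Z c e i d =
    ∑ p : Fin 3 × Fin 3 × Fin 3 × Fin 3,
      Z p.1 p.2.2.2 p.2.2.2 c * Z d p.1 e p.2.1 * Z p.2.1 p.2.2.1 p.2.2.1 i := by
  simp only [innerDressed, sum_mul, mul_sum, Fintype.sum_prod_type]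

theorem left6Z1_eq_sum (Z : Tensor4) (c f j k : Fin 3) : left6Z1 Z c f j k =
    ∑ p : Fin 3 × Fin 3 × Fin 3 × Fin 3,
      Z p.2.2.1 p.2.2.2 c p.1 * Z p.2.2.2 p.2.2.1 p.2.1 f * Z p.1 j k p.2.1 := by
  simp only [left6Z1, bubble, sum_mul, Fintype.sum_prod_type]

theorem right6Z1_eq_sum (Z : Tensor4) (c f j k : Fin 3) : right6Z1 Z c f j k =
    ∑ p : Fin 3 × Fin 3 × Fin 3 × Fin 3,
      Z p.2.2.1 c p.2.2.2 p.1 * Z j p.2.2.1 p.2.1 p.2.2.2 * Z f k p.1 p.2.1 := by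
  simp only [right6Z1, sum_mul, Fintype.sum_prod_type]

theorem left6Z2_eq_sum (Z : Tensor4) (c f j k : Fin 3) : left6Z2 Z c f j k =
    ∑ p : Fin 3 × Fin 3 × Fin 3 × Fin 3,
      Z p.2.2.1 p.2.2.2 c p.1 * Z p.2.2.2 p.2.2.1 p.2.1 f * Z p.1 p.2.1 j k := by
  simp only [left6Z2, bubble, sum_mul, Fintype.sum_prod_type]

theorem right6Z2_eq_sum (Z : Tensor4) (c f j k : Fin 3) : right6Z2 Z c f j k =
    ∑ p : Fin 3 × Fin 3 × Fin 3 × Fin 3,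
      Z p.2.2.1 c p.1 p.2.2.2 * Z p.2.1 p.2.2.1 p.2.2.2 j * Z f p.1 k p.2.1 := by
  simp only [right6Z2, sum_mul, Fintype.sum_prod_type]

theorem left7Z_eq_sum (Z : Tensor4) (e f g h : Fin 3) : left7Z Z e f g h =
    ∑ p : Fin 3 × Fin 3 × Fin 3 × Fin 3,
      Z p.2.2.1 p.1 p.2.2.2 p.2.1 * Z e p.2.2.1 f p.2.2.2 * Z p.1 g p.2.1 h := by
  simp only [left7Z, sum_mul, Fintype.sum_prod_type]

theorem right7Z_eq_sum (Z : Tensor4) (e f g h : Fin 3) : right7Z Z e f g h =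
    ∑ p : Fin 3 × Fin 3 × Fin 3 × Fin 3 × Fin 3 × Fin 3,
      Z g f p.1 p.2.1 * (Z h p.1 p.2.2.1 p.2.2.2.1 * (Z p.2.2.2.2.1 e p.2.2.2.2.2 p.2.2.1 * Z p.2.1 p.2.2.2.2.1 p.2.2.2.1 p.2.2.2.2.2)) := by
  simp only [right7Z, cross7Z, mul_sum, Fintype.sum_prod_type]

theorem I5Z1_eq_im (Z : Tensor4) : I5Z1 Z = (value5Z1 Z).im := by
  rw [I5Z1_eq_contract]
  refine congrArg Complex.im ?_
  simp only [value5Z1, ladder_eq_sum, outerDressed_eq_sum, sum_mul_sum]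
  simp only [← Fintype.sum_prod_type']
  let σ : (Fin 10 → Fin 3) ≃ Fin 3 × Fin 3 × Fin 3 × Fin 3 × (Fin 3 × Fin 3) × Fin 3 × Fin 3 ×
      Fin 3 × Fin 3 :=
    { toFun := fun x =>
        ⟨x 2, x 4, x 8, x 3, ⟨x 6, x 7⟩, x 1, x 5, x 9, x 0⟩
      invFun := fun ⟨c, e, i, d, ⟨g, h⟩, b, f, j, a⟩ =>
        ![a, b, c, d, e, f, g, h, i, j]
      left_inv := fun x => by ext i; fin_cases i <;> rfl
      right_inv := fun _ => rfl }
  refine Fintype.sum_equiv σ _ _ fun x => ?_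
  rw [Fin.prod_univ_five]
  exact (by ring :
    Z (x 0) (x 0) (x 1) (x 2) * Z (x 3) (x 1) (x 4) (x 5) * Z (x 2) (x 6) (x 7) (x 4) * Z (x 8)
      (x 3) (x 6) (x 7) * Z (x 5) (x 8) (x 9) (x 9) =
    (Z (x 2) (x 6) (x 7) (x 4) * Z (x 8) (x 3) (x 6) (x 7)) * (Z (x 0) (x 0) (x 1) (x 2) * Z (x
      3) (x 1) (x 4) (x 5) * Z (x 5) (x 8) (x 9) (x 9)))

theorem I5Z2_eq_im (Z : Tensor4) : I5Z2 Z = (value5Z2 Z).im := by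
  rw [I5Z2_eq_contract]
  refine congrArg Complex.im ?_
  simp only [value5Z2, ladder_eq_sum, innerDressed_eq_sum, sum_mul_sum]
  simp only [← Fintype.sum_prod_type']
  let σ : (Fin 10 → Fin 3) ≃ Fin 3 × Fin 3 × Fin 3 × Fin 3 × (Fin 3 × Fin 3) × Fin 3 × Fin 3 ×
      Fin 3 × Fin 3 :=
    { toFun := fun x =>
        ⟨x 2, x 4, x 8, x 3, ⟨x 6, x 7⟩, x 0, x 5, x 9, x 1⟩
      invFun := fun ⟨c, e, i, d, ⟨g, h⟩, a, f, j, b⟩ =>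
        ![a, b, c, d, e, f, g, h, i, j]
      left_inv := fun x => by ext i; fin_cases i <;> rfl
      right_inv := fun _ => rfl }
  refine Fintype.sum_equiv σ _ _ fun x => ?_
  rw [Fin.prod_univ_five]
  exact (by ring :
    Z (x 0) (x 1) (x 1) (x 2) * Z (x 3) (x 0) (x 4) (x 5) * Z (x 2) (x 6) (x 7) (x 4) * Z (x 8)
      (x 3) (x 6) (x 7) * Z (x 5) (x 9) (x 9) (x 8) =
    (Z (x 2) (x 6) (x 7) (x 4) * Z (x 8) (x 3) (x 6) (x 7)) * (Z (x 0) (x 1) (x 1) (x 2) * Z (x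
      3) (x 0) (x 4) (x 5) * Z (x 5) (x 9) (x 9) (x 8)))

theorem I6Z1_eq_im (Z : Tensor4) : I6Z1 Z = (value6Z1 Z).im := by
  rw [I6Z1_eq_contract]
  refine congrArg Complex.im ?_
  simp only [value6Z1, left6Z1_eq_sum, right6Z1_eq_sum, sum_mul_sum]
  simp only [← Fintype.sum_prod_type']
  let σ : (Fin 12 → Fin 3) ≃ Fin 3 × Fin 3 × Fin 3 × Fin 3 × (Fin 3 × Fin 3 × Fin 3 × Fin 3) ×
      Fin 3 × Fin 3 × Fin 3 × Fin 3 :=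
    { toFun := fun x =>
        ⟨x 2, x 5, x 9, x 10, ⟨x 3, x 4, x 0, x 1⟩, x 8, x 11, x 6, x 7⟩
      invFun := fun ⟨c, f, j, k, ⟨d, e, a, b⟩, i, l, g, h⟩ =>
        ![a, b, c, d, e, f, g, h, i, j, k, l]
      left_inv := fun x => by ext i; fin_cases i <;> rfl
      right_inv := fun _ => rfl }
  refine Fintype.sum_equiv σ _ _ fun x => ?_
  rw [Fin.prod_univ_six]
  exact (by ring :
    Z (x 0) (x 1) (x 2) (x 3) * Z (x 1) (x 0) (x 4) (x 5) * Z (x 6) (x 2) (x 7) (x 8) * Z (x 3)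
      (x 9) (x 10) (x 4) * Z (x 5) (x 10) (x 8) (x 11) * Z (x 9) (x 6) (x 11) (x 7) =
    (Z (x 0) (x 1) (x 2) (x 3) * Z (x 1) (x 0) (x 4) (x 5) * Z (x 3) (x 9) (x 10) (x 4)) * (Z (x
      6) (x 2) (x 7) (x 8) * Z (x 9) (x 6) (x 11) (x 7) * Z (x 5) (x 10) (x 8) (x 11)))

theorem I6Z2_eq_im (Z : Tensor4) : I6Z2 Z = (value6Z2 Z).im := by
  rw [I6Z2_eq_contract]
  refine congrArg Complex.im ?_
  simp only [value6Z2, left6Z2_eq_sum, right6Z2_eq_sum, sum_mul_sum]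
  simp only [← Fintype.sum_prod_type']
  let σ : (Fin 12 → Fin 3) ≃ Fin 3 × Fin 3 × Fin 3 × Fin 3 × (Fin 3 × Fin 3 × Fin 3 × Fin 3) ×
      Fin 3 × Fin 3 × Fin 3 × Fin 3 :=
    { toFun := fun x =>
        ⟨x 2, x 5, x 9, x 10, ⟨x 3, x 4, x 0, x 1⟩, x 7, x 11, x 6, x 8⟩
      invFun := fun ⟨c, f, j, k, ⟨d, e, a, b⟩, h, l, g, i⟩ =>
        ![a, b, c, d, e, f, g, h, i, j, k, l]
      left_inv := fun x => by ext i; fin_cases i <;> rfl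
      right_inv := fun _ => rfl }
  refine Fintype.sum_equiv σ _ _ fun x => ?_
  rw [Fin.prod_univ_six]
  exact (by ring :
    Z (x 0) (x 1) (x 2) (x 3) * Z (x 1) (x 0) (x 4) (x 5) * Z (x 6) (x 2) (x 7) (x 8) * Z (x 3)
      (x 4) (x 9) (x 10) * Z (x 5) (x 7) (x 10) (x 11) * Z (x 11) (x 6) (x 8) (x 9) =
    (Z (x 0) (x 1) (x 2) (x 3) * Z (x 1) (x 0) (x 4) (x 5) * Z (x 3) (x 4) (x 9) (x 10)) * (Z (x
      6) (x 2) (x 7) (x 8) * Z (x 11) (x 6) (x 8) (x 9) * Z (x 5) (x 7) (x 10) (x 11)))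

theorem I7Z_eq_im (Z : Tensor4) : I7Z Z = (value7Z Z).im := by
  rw [I7Z_eq_contract]
  refine congrArg Complex.im ?_
  simp only [value7Z, left7Z_eq_sum, right7Z_eq_sum, sum_mul_sum]
  simp only [← Fintype.sum_prod_type']
  let σ : (Fin 14 → Fin 3) ≃ Fin 3 × Fin 3 × Fin 3 × Fin 3 × (Fin 3 × Fin 3 × Fin 3 × Fin 3) ×
      Fin 3 × Fin 3 × Fin 3 × Fin 3 × Fin 3 × Fin 3 :=
    { toFun := fun x =>
        ⟨x 4, x 5, x 6, x 7, ⟨x 1, x 3, x 0, x 2⟩, x 11, x 12, x 10, x 13, x 8, x 9⟩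
      invFun := fun ⟨e, f, g, h, ⟨b, d, a, c⟩, l, m, k, n, i, j⟩ =>
        ![a, b, c, d, e, f, g, h, i, j, k, l, m, n]
      left_inv := fun x => by ext i; fin_cases i <;> rfl
      right_inv := fun _ => rfl }
  refine Fintype.sum_equiv σ _ _ fun x => ?_
  rw [Fin.prod_univ_seven]
  exact (by ring :
    Z (x 0) (x 1) (x 2) (x 3) * Z (x 4) (x 0) (x 5) (x 2) * Z (x 1) (x 6) (x 3) (x 7) * Z (x 8)
      (x 4) (x 9) (x 10) * Z (x 6) (x 5) (x 11) (x 12) * Z (x 7) (x 11) (x 10) (x 13) * Z (x 12)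
      (x 8) (x 13) (x 9) =
    (Z (x 0) (x 1) (x 2) (x 3) * Z (x 4) (x 0) (x 5) (x 2) * Z (x 1) (x 6) (x 3) (x 7)) * (Z (x
      6) (x 5) (x 11) (x 12) * (Z (x 7) (x 11) (x 10) (x 13) * (Z (x 8) (x 4) (x 9) (x 10) * Z
      (x 12) (x 8) (x 13) (x 9)))))

/-! ### The mixed invariant. -/

def value2Y3Z (Y : Tensor2) (Z : Tensor4) : ℂ :=
  ∑ b, ∑ f, ∑ g, ∑ h, (∑ c, ∑ d, (∑ a, Z a b c d * Y g a) * Z d c h f) * ∑ e, Z b e f g * Y e h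

theorem I2Y3Z_eq_sum (Y : Tensor2) (Z : Tensor4) :
    I2Y3Z Y Z = (∑ x : Fin 8 → Fin 3, Z (x 0) (x 1) (x 2) (x 3) * Z (x 1) (x 4) (x 5) (x 6) *
      Z (x 3) (x 2) (x 7) (x 5) * Y (x 6) (x 0) * Y (x 4) (x 7)).im := by
  refine congrArg Complex.im ?_
  iterate 8 rw [sum_vecCons]; refine sum_congr rfl fun _ _ => ?_
  rw [Fintype.sum_subsingleton _ ![]]
  rfl

theorem I2Y3Z_eq_im (Y : Tensor2) (Z : Tensor4) : I2Y3Z Y Z = (value2Y3Z Y Z).im := by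
  rw [I2Y3Z_eq_sum]
  refine congrArg Complex.im ?_
  have left : ∀ b f g h, (∑ c, ∑ d, (∑ a, Z a b c d * Y g a) * Z d c h f) =
      ∑ p : Fin 3 × Fin 3 × Fin 3, Z p.2.2 b p.1 p.2.1 * Y g p.2.2 * Z p.2.1 p.1 h f := by
    intro b f g h
    simp only [sum_mul, Fintype.sum_prod_type]
  simp only [value2Y3Z, left, sum_mul_sum]
  simp only [← Fintype.sum_prod_type']
  let σ : (Fin 8 → Fin 3) ≃ Fin 3 × Fin 3 × Fin 3 × Fin 3 × (Fin 3 × Fin 3 × Fin 3) × Fin 3 :=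
    { toFun := fun x => ⟨x 1, x 5, x 6, x 7, ⟨x 2, x 3, x 0⟩, x 4⟩
      invFun := fun ⟨b, f, g, h, ⟨c, d, a⟩, e⟩ => ![a, b, c, d, e, f, g, h]
      left_inv := fun x => by ext i; fin_cases i <;> rfl
      right_inv := fun _ => rfl }
  refine Fintype.sum_equiv σ _ _ fun x => ?_
  exact (by ring : Z (x 0) (x 1) (x 2) (x 3) * Z (x 1) (x 4) (x 5) (x 6) *
      Z (x 3) (x 2) (x 7) (x 5) * Y (x 6) (x 0) * Y (x 4) (x 7) =
    Z (x 0) (x 1) (x 2) (x 3) * Y (x 6) (x 0) * Z (x 3) (x 2) (x 7) (x 5) *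
      (Z (x 1) (x 4) (x 5) (x 6) * Y (x 4) (x 7)))

/-- The bilinear couplings as a degenerate quartic tensor. -/
def tensorYδ (Y : Tensor2) : Tensor4 := fun a b c d => Y a b * if d = c then 1 else 0

theorem changeZ_tensorYδ {U : Matrix (Fin 3) (Fin 3) ℂ} (hU : U ∈ Matrix.unitaryGroup (Fin 3) ℂ)
    (Y : Tensor2) : changeZ U (tensorYδ Y) = tensorYδ (changeY U Y) := by
  have h : ∀ c d, ∑ r, star (U r c) * U r d = if d = c then 1 else 0 := fun c d => by
    have h := congrFun (congrFun (Matrix.mem_unitaryGroup_iff'.1 hU) c) d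
    simpa [Matrix.mul_apply, Matrix.one_apply, eq_comm] using h
  funext a b c d
  simp only [changeZ, tensorYδ, changeY, ← h c d, sum_mul]
  refine sum_congr rfl fun p _ => sum_congr rfl fun q _ => ?_
  rw [mul_sum]
  refine sum_congr rfl fun r _ => ?_
  simp only [mul_ite, mul_zero, mul_one, sum_ite_eq', mem_univ, if_true]
  ring

/-- Lines `8` and `9` are loops closing the Kronecker delta of each `tensorYδ Y`; each loop has
trace `3`, whence the factor `9`. Invariance of pure quartic contractions thereby covers the mixed
one. -/
theorem contract_tensorYδ (Y : Tensor2) (Z : Tensor4) :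
    contract (E := Fin 10)
      (fun s : Fin 5 × Fin 2 => ![![0, 2], ![1, 5], ![3, 7], ![6, 8], ![4, 9]] s.1 s.2)
      (fun s => ![![1, 3], ![4, 6], ![2, 5], ![0, 8], ![7, 9]] s.1 s.2)
      ![Z, Z, Z, tensorYδ Y, tensorYδ Y] =
    9 * ∑ x : Fin 8 → Fin 3, Z (x 0) (x 1) (x 2) (x 3) * Z (x 1) (x 4) (x 5) (x 6) *
      Z (x 3) (x 2) (x 7) (x 5) * Y (x 6) (x 0) * Y (x 4) (x 7) := by
  rw [mul_sum]
  unfold contract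
  rw [sum_vecCons, sum_vecCons]; refine sum_congr rfl fun a _ => ?_
  rw [sum_vecCons, sum_vecCons]; refine sum_congr rfl fun b _ => ?_
  rw [sum_vecCons, sum_vecCons]; refine sum_congr rfl fun c _ => ?_
  rw [sum_vecCons, sum_vecCons]; refine sum_congr rfl fun d _ => ?_
  rw [sum_vecCons, sum_vecCons]; refine sum_congr rfl fun e _ => ?_
  rw [sum_vecCons, sum_vecCons]; refine sum_congr rfl fun f _ => ?_
  rw [sum_vecCons, sum_vecCons]; refine sum_congr rfl fun g _ => ?_
  rw [sum_vecCons, sum_vecCons]; refine sum_congr rfl fun h' _ => ?_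
  rw [Fintype.sum_subsingleton (fun x : Fin 0 → Fin 3 => (9 : ℂ) * _) ![]]
  calc _ = ∑ _i : Fin 3, ∑ _j : Fin 3, Z a b c d * Z b e f g * Z d c h' f * Y g a * Y e h' := ?_
    _ = _ := by
      simp only [sum_const, card_univ, Fintype.card_fin, nsmul_eq_mul]
      norm_num [← mul_assoc]
      rfl
  rw [sum_vecCons]; refine sum_congr rfl fun i _ => ?_
  rw [sum_vecCons]; refine sum_congr rfl fun j _ => ?_
  rw [Fintype.sum_subsingleton _ ![], Fin.prod_univ_five]
  have h : ∀ m n : Fin 3, ∀ k, tensorYδ Y m n k k = Y m n := fun m n k => by simp [tensorYδ]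
  rw [← h g a i, ← h e h' j]
  rfl

/-! ### Basis invariance and CP-oddness. -/

theorem invariants_change (Y : Tensor2) (Z : Tensor4) {U : Matrix (Fin 3) (Fin 3) ℂ}
    (hU : U ∈ Matrix.unitaryGroup (Fin 3) ℂ) :
    invariants (changeY U Y) (changeZ U Z) = invariants Y Z := by
  have h23 : I2Y3Z (changeY U Y) (changeZ U Z) = I2Y3Z Y Z := by
    rw [I2Y3Z_eq_sum, I2Y3Z_eq_sum]
    refine congrArg Complex.im (mul_left_cancel₀ (by norm_num : (9 : ℂ) ≠ 0) ?_)
    rw [← contract_tensorYδ, ← contract_tensorYδ, ← changeZ_tensorYδ hU]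
    refine Eq.trans ?_ (contract_changeZ (by decide) (by decide) hU _)
    congr 1
    funext k
    fin_cases k <;> rfl
  unfold invariants
  rw [h23, I5Z1_eq_contract, I5Z2_eq_contract, I6Z1_eq_contract, I6Z2_eq_contract, I7Z_eq_contract,
    contract_changeZ (by decide) (by decide) hU, contract_changeZ (by decide) (by decide) hU,
    contract_changeZ (by decide) (by decide) hU, contract_changeZ (by decide) (by decide) hU,
    contract_changeZ (by decide) (by decide) hU, ← I5Z1_eq_contract, ← I5Z2_eq_contract,
    ← I6Z1_eq_contract, ← I6Z2_eq_contract, ← I7Z_eq_contract]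

theorem contract_star {v E : Type*} [Fintype v] [Fintype E] [DecidableEq E]
    (α β : v × Fin 2 → E) (Z : v → Tensor4) :
    contract α β (fun k a b c d => star (Z k a b c d)) = star (contract α β Z) := by
  simp only [contract, star_sum, star_prod]

theorem invariants_star (Y : Tensor2) (Z : Tensor4) :
    invariants (fun a b => star (Y a b)) (fun a b c d => star (Z a b c d)) = -invariants Y Z := by
  have h23 : I2Y3Z (fun a b => star (Y a b)) (fun a b c d => star (Z a b c d)) = -I2Y3Z Y Z := by
    rw [I2Y3Z_eq_sum, I2Y3Z_eq_sum, ← Complex.conj_im]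
    simp only [map_sum, map_mul]
    rfl
  have h : ∀ z : ℂ, (star z).im = -z.im := fun z => Complex.conj_im z
  unfold invariants
  rw [h23, I5Z1_eq_contract, I5Z2_eq_contract, I6Z1_eq_contract, I6Z2_eq_contract, I7Z_eq_contract,
    contract_star, contract_star, contract_star, contract_star, contract_star,
    I5Z1_eq_contract, I5Z2_eq_contract, I6Z1_eq_contract, I6Z2_eq_contract, I7Z_eq_contract]
  simp only [h]
  funext i
  fin_cases i <;> rfl

/-! ### Antisymmetric parts of the invariants under the exchange of `y` and `y'`. -/

set_option maxHeartbeats 4000000 in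
theorem value5Z1_chargedZ_sub (a b c d e f g y y' : ℂ) :
    value5Z1 (chargedZ a b c d e f g g y y') - value5Z1 (chargedZ a b c d e f g g y' y) =
      2 * (y ^ 2 - y' ^ 2) * g * (a + b - d - f) ^ 2 := by
  simp only [value5Z1, ladder, outerDressed, Fin.sum_univ_three, chargedZ, Fin.isValue, Matrix.of_apply,
    Matrix.cons_val_zero, Matrix.cons_val_one, Matrix.cons_val, zero_mul, mul_zero, add_zero,
    zero_add]
  ring

set_option maxHeartbeats 4000000 in
theorem value5Z2_chargedZ_sub (a b c d e f g y y' : ℂ) :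
    value5Z2 (chargedZ a b c d e f g g y y') - value5Z2 (chargedZ a b c d e f g g y' y) =
      2 * (y ^ 2 - y' ^ 2) * g * (a + c - e - f) ^ 2 := by
  simp only [value5Z2, ladder, innerDressed, Fin.sum_univ_three, chargedZ, Fin.isValue, Matrix.of_apply,
    Matrix.cons_val_zero, Matrix.cons_val_one, Matrix.cons_val, zero_mul, mul_zero, add_zero,
    zero_add]
  ring

/-- The bilinear tensor of the potential, which takes the same form in both bases. -/
def diagY (m m' : ℂ) : Tensor2 := !![m, 0, 0; 0, m, 0; 0, 0, m']

set_option maxHeartbeats 4000000 in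
theorem value2Y3Z_chargedZ_sub (a b c d e f g y y' m m' : ℂ) :
    value2Y3Z (diagY m m') (chargedZ a b c d e f g g y y') - value2Y3Z (diagY m m') (chargedZ a b c d e f g g y' y) =
      2 * (y ^ 2 - y' ^ 2) * g * (m' - m) ^ 2 := by
  simp only [value2Y3Z, diagY, Fin.sum_univ_three, chargedZ, Fin.isValue, Matrix.of_apply,
    Matrix.cons_val_zero, Matrix.cons_val_one, Matrix.cons_val, zero_mul, mul_zero, add_zero,
    zero_add]
  ring

-- The entries `b - 2u`, `c - 2u`, `a + 2u` in the places of `d`, `e`, `f` parametrize the solutions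
-- of `a + b = d + f` and `a + c = e + f`, the relations imposed by the degree-five invariants when
-- `g (y² - y'²) ≠ 0`.
set_option maxHeartbeats 4000000 in
theorem value6Z1_chargedZ_sub (a b c u k y y' N x : ℂ) (hN : N = y * y' / 2)
    (hx : x = (b - a + c) / 4) :
    value6Z1 (chargedZ a b c (b - 2 * u) (c - 2 * u) (a + 2 * u) (2 * k) (2 * k) y y') - value6Z1 (chargedZ a b c (b - 2 * u) (c - 2 * u) (a + 2 * u) (2 * k) (2 * k) y' y) =
      48 * (y ^ 2 - y' ^ 2) * k * u * (N - 2 * k ^ 2 + 8 * x * u - 6 * u ^ 2) := by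
  subst hN hx
  simp only [value6Z1, left6Z1, right6Z1, bubble, Fin.sum_univ_three, chargedZ, Fin.isValue, Matrix.of_apply,
    Matrix.cons_val_zero, Matrix.cons_val_one, Matrix.cons_val, zero_mul, mul_zero, add_zero,
    zero_add]
  ring

set_option maxHeartbeats 4000000 in
theorem value6Z2_chargedZ_sub (a b c u k y y' N x : ℂ) (hN : N = y * y' / 2)
    (hx : x = (b - a + c) / 4) :
    value6Z2 (chargedZ a b c (b - 2 * u) (c - 2 * u) (a + 2 * u) (2 * k) (2 * k) y y') - value6Z2 (chargedZ a b c (b - 2 * u) (c - 2 * u) (a + 2 * u) (2 * k) (2 * k) y' y) =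
      48 * (y ^ 2 - y' ^ 2) * k * (k * (y ^ 2 + y' ^ 2) / 2 - 4 * N * x + 3 * N * u - 4 * k ^ 2 * x
        + 4 * k ^ 2 * u + 16 * x ^ 3 - 40 * x ^ 2 * u + 36 * x * u ^ 2 - 12 * u ^ 3) := by
  subst hN hx
  simp only [value6Z2, left6Z2, right6Z2, bubble, Fin.sum_univ_three, chargedZ, Fin.isValue, Matrix.of_apply,
    Matrix.cons_val_zero, Matrix.cons_val_one, Matrix.cons_val, zero_mul, mul_zero, add_zero,
    zero_add]
  ring

set_option maxHeartbeats 4000000 in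
theorem value7Z_chargedZ_sub (a b c u k y y' N x : ℂ) (hN : N = y * y' / 2)
    (hx : x = (b - a + c) / 4) :
    value7Z (chargedZ a b c (b - 2 * u) (c - 2 * u) (a + 2 * u) (2 * k) (2 * k) y y') - value7Z (chargedZ a b c (b - 2 * u) (c - 2 * u) (a + 2 * u) (2 * k) (2 * k) y' y) =
      32 * (y ^ 2 - y' ^ 2) * k * ((N - 2 * k ^ 2) ^ 2 - 2 * N * x * u - 3 * N * u ^ 2
        + 4 * k ^ 2 * x * u - 12 * k ^ 2 * u ^ 2 - 8 * x ^ 2 * u ^ 2 + 12 * x * u ^ 3) := by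
  subst hN hx
  simp only [value7Z, left7Z, right7Z, cross7Z, Fin.sum_univ_three, chargedZ, Fin.isValue, Matrix.of_apply,
    Matrix.cons_val_zero, Matrix.cons_val_one, Matrix.cons_val, zero_mul, mul_zero, add_zero,
    zero_add]
  ring

/-! ### Potentials and their tensors -/

/-- The bilinear form of the doublets with coefficient tensor `Y`. -/
def quadratic (Y : Tensor2) (h : Doublets) : ℂ := ∑ a, ∑ b, Y a b * bil h a b

/-- The quadrilinear form of the doublets with coefficient tensor `Z`. -/
def quartic (Z : Tensor4) (h : Doublets) : ℂ :=
  ∑ a, ∑ b, ∑ c, ∑ d, Z a b c d * bil h a b * bil h c d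

/-- The doublets `∑_b U_ab h_b`. -/
def act (U : Matrix (Fin 3) (Fin 3) ℂ) (h : Doublets) : Doublets := fun a i => ∑ b, U a b * h b i

theorem act_act (U W : Matrix (Fin 3) (Fin 3) ℂ) (h : Doublets) :
    act U (act W h) = act (U * W) h := by
  funext a i
  simp only [act, Matrix.mul_apply, mul_sum, sum_mul]
  rw [sum_comm]
  exact sum_congr rfl fun _ _ => sum_congr rfl fun _ _ => by ring

theorem act_one (h : Doublets) : act 1 h = h := by
  funext a i
  simp [act, Matrix.one_apply]

theorem cpTransform_eq_act (X : Matrix (Fin 3) (Fin 3) ℂ) (h : Doublets) :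
    cpTransform X h = act X (star h) := rfl

theorem star_act (U : Matrix (Fin 3) (Fin 3) ℂ) (h : Doublets) :
    star (act U h) = act (U.map star) (star h) := by
  funext a i
  simp [act]

theorem bil_act (U : Matrix (Fin 3) (Fin 3) ℂ) (h : Doublets) (p q : Fin 3) :
    bil (act U h) p q = ∑ a, ∑ b, star (U p a) * U q b * bil h a b := by
  simp only [bil, act, star_sum, sum_mul_sum]
  simp only [mul_sum]
  rw [sum_comm]
  refine sum_congr rfl fun a _ => ?_
  rw [sum_comm]
  refine sum_congr rfl fun b _ => sum_congr rfl fun i _ => ?_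
  rw [star_mul']
  ring

theorem bil_star (h : Doublets) (a b : Fin 3) : bil (star h) a b = bil h b a := by
  simp [bil, mul_comm]

theorem quadratic_act (U : Matrix (Fin 3) (Fin 3) ℂ) (Y : Tensor2) (h : Doublets) :
    quadratic Y (act U h) = quadratic (changeY U Y) h := by
  simp only [quadratic, changeY, bil_act, mul_sum, sum_mul]
  simp only [← Fintype.sum_prod_type']
  let σ : Fin 3 × Fin 3 × Fin 3 × Fin 3 ≃ Fin 3 × Fin 3 × Fin 3 × Fin 3 :=
    ⟨fun ⟨p, q, a, b⟩ => ⟨a, b, p, q⟩, fun ⟨a, b, p, q⟩ => ⟨p, q, a, b⟩, fun _ => rfl, fun _ => rfl⟩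
  refine Fintype.sum_equiv σ _ _ fun x => ?_
  exact (by ring : Y x.1 x.2.1 * (star (U x.1 x.2.2.1) * U x.2.1 x.2.2.2 * bil h x.2.2.1 x.2.2.2) =
    star (U x.1 x.2.2.1) * U x.2.1 x.2.2.2 * Y x.1 x.2.1 * bil h x.2.2.1 x.2.2.2)

theorem sum_four_swap {M : Type*} [AddCommMonoid M] (F : Fin 3 → Fin 3 → Fin 3 → Fin 3 → M) :
    ∑ a, ∑ b, ∑ c, ∑ d, F a b c d = ∑ a, ∑ b, ∑ c, ∑ d, F c d a b := by
  simp only [← Fintype.sum_prod_type']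
  let σ : Fin 3 × Fin 3 × Fin 3 × Fin 3 ≃ Fin 3 × Fin 3 × Fin 3 × Fin 3 :=
    ⟨fun ⟨p, q, a, b⟩ => ⟨a, b, p, q⟩, fun ⟨a, b, p, q⟩ => ⟨p, q, a, b⟩, fun _ => rfl, fun _ => rfl⟩
  exact Fintype.sum_equiv σ _ _ fun x => rfl

theorem quartic_act (U : Matrix (Fin 3) (Fin 3) ℂ) (Z : Tensor4) (h : Doublets) :
    quartic Z (act U h) = quartic (changeZ U Z) h := by
  have lhs : ∀ p q r s, Z p q r s * bil (act U h) p q * bil (act U h) r s =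
      ∑ x : Fin 3 × Fin 3, ∑ y : Fin 3 × Fin 3, star (U p x.1) * U q x.2 * star (U r y.1) *
        U s y.2 * Z p q r s * bil h x.1 x.2 * bil h y.1 y.2 := by
    intro p q r s
    rw [mul_assoc, bil_act, bil_act, ← Fintype.sum_prod_type', ← Fintype.sum_prod_type',
      sum_mul_sum, mul_sum]
    refine sum_congr rfl fun x _ => ?_
    rw [mul_sum]
    exact sum_congr rfl fun y _ => by ring
  simp only [quartic, lhs, changeZ, sum_mul]
  simp only [← Fintype.sum_prod_type']
  let σ : Fin 3 × Fin 3 × Fin 3 × Fin 3 × (Fin 3 × Fin 3) × Fin 3 × Fin 3 ≃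
      Fin 3 × Fin 3 × Fin 3 × Fin 3 × Fin 3 × Fin 3 × Fin 3 × Fin 3 :=
    { toFun := fun ⟨p, q, r, s, ⟨a, b⟩, c, d⟩ => ⟨a, b, c, d, p, q, r, s⟩
      invFun := fun ⟨a, b, c, d, p, q, r, s⟩ => ⟨p, q, r, s, ⟨a, b⟩, c, d⟩
      left_inv := fun _ => rfl
      right_inv := fun _ => rfl }
  exact Fintype.sum_equiv σ _ _ fun x => rfl

/-- `Z_abcd = Z_cdab`. -/
def PairSymm (Z : Tensor4) : Prop := ∀ a b c d, Z a b c d = Z c d a b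

theorem PairSymm.changeZ {Z : Tensor4} (hZ : PairSymm Z) (U : Matrix (Fin 3) (Fin 3) ℂ) :
    PairSymm (changeZ U Z) := by
  intro a b c d
  unfold S3HDM.changeZ
  rw [sum_four_swap]
  exact sum_congr rfl fun p _ => sum_congr rfl fun q _ => sum_congr rfl fun r _ =>
    sum_congr rfl fun s _ => by rw [hZ r s p q]; ring

/-- Polarization: basis vectors kill the diagonal, while `e_a + e_b` and `e_a + i e_b` give `M_ab +
M_ba = 0` and `i (M_ab - M_ba) = 0`. -/
theorem eq_zero_of_sesquilinear_eq_zero {M : Tensor2}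
    (hM : ∀ u : Fin 3 → ℂ, ∑ a, ∑ b, M a b * (star (u a) * u b) = 0) (a b : Fin 3) :
    M a b = 0 := by
  have hd : ∀ a, M a a = 0 := fun a => by
    simpa [Pi.single_apply] using hM (Pi.single a 1)
  have solve : ∀ m n : ℂ, m + n = 0 → m * Complex.I - n * Complex.I = 0 → m = 0 ∧ n = 0 := by
    intro m n h1 h2
    have h3 : m - n = 0 := by
      have := congrArg (· * -Complex.I) h2
      simp only [zero_mul] at this
      linear_combination this + (m - n) * Complex.I_mul_I
    exact ⟨by linear_combination (h1 + h3) / 2, by linear_combination (h1 - h3) / 2⟩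
  have h01 := solve (M 0 1) (M 1 0)
    (by simpa [Fin.sum_univ_three, hd] using hM ![1, 1, 0])
    (by simpa [Fin.sum_univ_three, hd, sub_eq_add_neg] using hM ![1, Complex.I, 0])
  have h02 := solve (M 0 2) (M 2 0)
    (by simpa [Fin.sum_univ_three, hd] using hM ![1, 0, 1])
    (by simpa [Fin.sum_univ_three, hd, sub_eq_add_neg] using hM ![1, 0, Complex.I])
  have h12 := solve (M 1 2) (M 2 1)
    (by simpa [Fin.sum_univ_three, hd] using hM ![0, 1, 1])
    (by simpa [Fin.sum_univ_three, hd, sub_eq_add_neg] using hM ![0, 1, Complex.I])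
  fin_cases a <;> fin_cases b
  exacts [hd 0, h01.1, h02.1, h01.2, hd 1, h12.1, h02.2, h12.2, hd 2]

theorem quadratic_injective {Y Y' : Tensor2} (h : ∀ x, quadratic Y x = quadratic Y' x) :
    Y = Y' := by
  funext a b
  refine sub_eq_zero.1 (eq_zero_of_sesquilinear_eq_zero (M := fun a b => Y a b - Y' a b) ?_ a b)
  intro u
  have := h fun a => ![u a, 0]
  simp only [quadratic, bil, Fin.sum_univ_two, Matrix.cons_val_zero, Matrix.cons_val_one, mul_zero,
    add_zero] at this
  simp only [sub_mul, sum_sub_distrib, this, sub_self]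

/-- Doublets have two components, so their bilinears include all sums `P u + P v` of two rank-one
matrices. A symmetric bilinear form vanishing on the diagonal at all such sums satisfies `B (P u) (P
v) = 0`, and sesquilinear polarization in `u` and in `v` recovers every entry. -/
theorem quartic_injective {Z Z' : Tensor4} (hZ : PairSymm Z) (hZ' : PairSymm Z')
    (h : ∀ x, quartic Z x = quartic Z' x) : Z = Z' := by
  let D : Tensor4 := fun a b c d => Z a b c d - Z' a b c d
  have hD : PairSymm D := fun a b c d => by simp only [D, hZ a b c d, hZ' a b c d]
  let B : (Fin 3 → Fin 3 → ℂ) → (Fin 3 → Fin 3 → ℂ) → ℂ := fun K L =>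
    ∑ a, ∑ b, ∑ c, ∑ d, D a b c d * K a b * L c d
  have hB : ∀ K L, B K L = B L K := fun K L => by
    simp only [B]
    rw [sum_four_swap]
    exact sum_congr rfl fun p _ => sum_congr rfl fun q _ => sum_congr rfl fun r _ =>
      sum_congr rfl fun s _ => by rw [hD p q r s]; ring
  have hadd : ∀ K L M, B (K + L) M = B K M + B L M := fun K L M => by
    simp only [B, ← sum_add_distrib, Pi.add_apply]
    exact sum_congr rfl fun p _ => sum_congr rfl fun q _ => sum_congr rfl fun r _ =>
      sum_congr rfl fun s _ => by ring
  have hq : ∀ x, B (bil x) (bil x) = 0 := fun x => by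
    have := h x
    simp only [quartic] at this
    simp only [B, D, sub_mul, sum_sub_distrib, this, sub_self]
  let P : (Fin 3 → ℂ) → Fin 3 → Fin 3 → ℂ := fun u a b => star (u a) * u b
  have hP : ∀ u v, bil (fun a => ![u a, v a]) = P u + P v := fun u v => by
    funext a b
    simp [bil, P, Fin.sum_univ_two]
  have hPP : ∀ u, B (P u) (P u) = 0 := fun u => by
    have h0 := hq fun a => ![u a, (0 : Fin 3 → ℂ) a]
    have hP0 : P 0 = 0 := by funext a b; simp [P]
    rwa [hP, hP0, add_zero] at h0
  have huv : ∀ u v, B (P u) (P v) = 0 := fun u v => by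
    have h0 := hq fun a => ![u a, v a]
    rw [hP, hadd, hB (P u), hB (P v), hadd, hadd, hPP, hPP, hB (P v)] at h0
    simpa using h0
  funext a b c d
  refine sub_eq_zero.1 (eq_zero_of_sesquilinear_eq_zero (M := D a b) (fun v => ?_) c d)
  refine eq_zero_of_sesquilinear_eq_zero
    (M := fun a b => ∑ c, ∑ d, D a b c d * (star (v c) * v d)) (fun u => ?_) a b
  refine Eq.trans ?_ (huv u v)
  simp only [B, P, sum_mul]
  exact sum_congr rfl fun p _ => sum_congr rfl fun q _ => sum_congr rfl fun r _ =>
    sum_congr rfl fun s _ => by ring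

/-! ### Hermiticity of the tensors and the action of CP on them. -/

theorem tensorZ_pairSymm (p : Couplings) : PairSymm (tensorZ p) := by
  intro a b c d
  fin_cases a <;> fin_cases b <;> fin_cases c <;> fin_cases d <;> rfl

theorem star_tensorZ (p : Couplings) (a b c d : Fin 3) :
    star (tensorZ p a b c d) = tensorZ p b a d c := by
  have h1 : star (2 * p.l1 + 2 * p.l3 : ℂ) = 2 * p.l1 + 2 * p.l3 := by simp
  have h2 : star (2 * p.l1 - 2 * p.l3 : ℂ) = 2 * p.l1 - 2 * p.l3 := by simp
  have h3 : star (2 * p.l2 + 2 * p.l3 : ℂ) = 2 * p.l2 + 2 * p.l3 := by simp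
  have h4 : star (-2 * p.l2 + 2 * p.l3 : ℂ) = -2 * p.l2 + 2 * p.l3 := by simp
  have h5 : ∀ x : ℝ, star (x : ℂ) = x := Complex.conj_ofReal
  have h6 : star (2 * p.l8 : ℂ) = 2 * p.l8 := by simp
  have h7 : ∀ z : ℂ, star (2 * z) = 2 * star z := fun z => by simp
  have h8 : star (2 * star p.l7) = 2 * p.l7 := by simp
  have h9 : star (-star p.l4) = -p.l4 := by simp
  have h10 : star (-p.l4) = -star p.l4 := by simp
  fin_cases a <;> fin_cases b <;> fin_cases c <;> fin_cases d <;>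
    first
    | exact star_zero ℂ | exact h1 | exact h2 | exact h3 | exact h4 | exact h5 _ | exact h6
    | exact star_star _ | exact h8 | exact h9 | exact h10 | exact h7 _ | rfl

theorem star_tensorY (p : Couplings) (a b : Fin 3) : star (tensorY p a b) = tensorY p b a := by
  have h5 : ∀ x : ℝ, star (x : ℂ) = x := Complex.conj_ofReal
  fin_cases a <;> fin_cases b <;> first | exact star_zero ℂ | exact h5 _

theorem V2_eq_quadratic (p : Couplings) (h : Doublets) : V2 p h = quadratic (tensorY p) h :=
  V2_eq_tensorY p h

theorem V4_eq_quartic (p : Couplings) (h : Doublets) : V4 p h = 1 / 2 * quartic (tensorZ p) h :=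
  V4_eq_tensorZ p h

theorem quadratic_star (Y : Tensor2) (h : Doublets) :
    quadratic Y (star h) = quadratic (fun a b => Y b a) h := by
  simp only [quadratic, bil_star]
  exact sum_comm

theorem quartic_star (Z : Tensor4) (h : Doublets) :
    quartic Z (star h) = quartic (fun a b c d => Z b a d c) h := by
  simp only [quartic, bil_star]
  rw [sum_comm]
  exact sum_congr rfl fun a _ => sum_congr rfl fun b _ => sum_comm

theorem star_quadratic (Y : Tensor2) (h : Doublets) :
    star (quadratic Y h) = quadratic (fun a b => star (Y a b)) (star h) := by
  simp only [quadratic, bil_star, star_sum, star_mul', star_bil]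

theorem star_quartic (Z : Tensor4) (h : Doublets) :
    star (quartic Z h) = quartic (fun a b c d => star (Z a b c d)) (star h) := by
  simp only [quartic, bil_star, star_sum, star_mul', star_bil]

theorem star_quadratic_tensorY (p : Couplings) (h : Doublets) :
    star (quadratic (tensorY p) h) = quadratic (tensorY p) h := by
  rw [star_quadratic, quadratic_star]
  simp only [star_tensorY]

theorem star_quartic_tensorZ (p : Couplings) (h : Doublets) :
    star (quartic (tensorZ p) h) = quartic (tensorZ p) h := by
  rw [star_quartic, quartic_star]
  simp only [star_tensorZ]

/-- At the conjugate doublets the CP transformation acts linearly by `X`, while conjugating doublets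
transposes the tensor, which by hermiticity is complex conjugation. Comparing coefficients gives the
identity. -/
theorem changeY_eq_star_of_invariant {p : Couplings} {X : Matrix (Fin 3) (Fin 3) ℂ}
    (hX : ∀ h, V2 p (cpTransform X h) = V2 p h) :
    changeY X (tensorY p) = fun a b => star (tensorY p a b) := by
  refine quadratic_injective fun h => ?_
  have := hX (star h)
  rw [cpTransform_eq_act, star_star, V2_eq_quadratic, V2_eq_quadratic, quadratic_act,
    quadratic_star] at this
  simpa only [star_tensorY] using this

theorem changeZ_eq_star_of_invariant {p : Couplings} {X : Matrix (Fin 3) (Fin 3) ℂ}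
    (hX : ∀ h, V4 p (cpTransform X h) = V4 p h) :
    changeZ X (tensorZ p) = fun a b c d => star (tensorZ p a b c d) := by
  refine quartic_injective ((tensorZ_pairSymm p).changeZ X)
    (fun a b c d => by rw [tensorZ_pairSymm p]) fun h => ?_
  have := hX (star h)
  rw [cpTransform_eq_act, star_star, V4_eq_quartic, V4_eq_quartic, quartic_act,
    quartic_star] at this
  simpa [star_tensorZ] using this

theorem cpTransform_smul (X : Matrix (Fin 3) (Fin 3) ℂ) (h : Doublets) :
    cpTransform X ((2 : ℂ) • h) = (2 : ℂ) • cpTransform X h := by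
  funext a i
  simp [cpTransform, mul_sum, mul_left_comm]

theorem bil_two_smul (h : Doublets) (a b : Fin 3) : bil ((2 : ℂ) • h) a b = 4 * bil h a b := by
  simp only [bil, Pi.smul_apply, smul_eq_mul, mul_sum, star_mul', star_ofNat]
  exact sum_congr rfl fun _ _ => by ring

theorem V2_two_smul (p : Couplings) (h : Doublets) : V2 p ((2 : ℂ) • h) = 4 * V2 p h := by
  simp only [V2, bil_two_smul]
  ring

theorem V4_two_smul (p : Couplings) (h : Doublets) : V4 p ((2 : ℂ) • h) = 16 * V4 p h := by
  simp only [V4_eq_quartic, quartic, bil_two_smul, mul_sum]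
  exact sum_congr rfl fun p _ => sum_congr rfl fun q _ => sum_congr rfl fun r _ =>
    sum_congr rfl fun s _ => by ring

/-- `V2` and `V4` are homogeneous of degrees two and four, so the invariance conditions at `h` and
`2h` separate them. -/
theorem invariant_parts_of_invariant {p : Couplings} {X : Matrix (Fin 3) (Fin 3) ℂ}
    (hX : ∀ h, V p (cpTransform X h) = V p h) :
    (∀ h, V2 p (cpTransform X h) = V2 p h) ∧ ∀ h, V4 p (cpTransform X h) = V4 p h := by
  have key : ∀ h, V2 p (cpTransform X h) = V2 p h ∧ V4 p (cpTransform X h) = V4 p h := by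
    intro h
    have h1 := hX h
    have h2 := hX ((2 : ℂ) • h)
    simp only [V, cpTransform_smul, V2_two_smul, V4_two_smul] at h1 h2
    exact ⟨by linear_combination (16 * h1 - h2) / 12, by linear_combination (h2 - 4 * h1) / 12⟩
  exact ⟨fun h => (key h).1, fun h => (key h).2⟩

theorem pure_invariants_eq_zero {p : Couplings} (hp : ExplicitlyConservesCP (V4 p)) :
    I5Z1 (tensorZ p) = 0 ∧ I5Z2 (tensorZ p) = 0 ∧ I6Z1 (tensorZ p) = 0 ∧ I6Z2 (tensorZ p) = 0 ∧
      I7Z (tensorZ p) = 0 := by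
  obtain ⟨X, hXu, hX⟩ := hp
  have h1 := invariants_change 0 (tensorZ p) hXu
  -- The bilinear tensor is irrelevant to the first five components; it is chosen so that the left
  -- side matches that of `h1` once the double conjugation is removed.
  have h2 := invariants_star (fun a b => star (changeY X 0 a b)) (tensorZ p)
  rw [changeZ_eq_star_of_invariant hX] at h1
  simp only [star_star] at h2
  have h3 := h1.symm.trans h2
  have H : ∀ {x : ℝ}, x = -x → x = 0 := fun hx => by linarith
  exact ⟨H (congrFun h3 0), H (congrFun h3 1), H (congrFun h3 2), H (congrFun h3 3),
    H (congrFun h3 4)⟩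

theorem conservesCP_V4_of_V {p : Couplings} (hp : ExplicitlyConservesCP (V p)) :
    ExplicitlyConservesCP (V4 p) := by
  obtain ⟨X, hXu, hX⟩ := hp
  exact ⟨X, hXu, (invariant_parts_of_invariant hX).2⟩

theorem mixed_invariant_eq_zero {p : Couplings} (hp : ExplicitlyConservesCP (V p)) :
    I2Y3Z (tensorY p) (tensorZ p) = 0 := by
  obtain ⟨X, hXu, hX⟩ := hp
  obtain ⟨hX2, hX4⟩ := invariant_parts_of_invariant hX
  have h1 := invariants_change (tensorY p) (tensorZ p) hXu
  rw [changeZ_eq_star_of_invariant hX4, changeY_eq_star_of_invariant hX2, invariants_star] at h1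
  have h2 : -I2Y3Z (tensorY p) (tensorZ p) = I2Y3Z (tensorY p) (tensorZ p) := congrFun h1 5
  linarith

/-! ### From a real basis to a CP transformation. -/

theorem quadratic_star_of_real {Y : Tensor2} (hY : ∀ a b, (Y a b).im = 0) (h : Doublets) :
    quadratic Y (star h) = star (quadratic Y h) := by
  rw [star_quadratic]
  congr 1
  funext a b
  exact (Complex.conj_eq_iff_im.2 (hY a b)).symm

theorem quartic_star_of_real {Z : Tensor4} (hZ : ∀ a b c d, (Z a b c d).im = 0) (h : Doublets) :
    quartic Z (star h) = star (quartic Z h) := by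
  rw [star_quartic]
  congr 1
  funext a b c d
  exact (Complex.conj_eq_iff_im.2 (hZ a b c d)).symm

theorem transpose_mem_unitaryGroup {U : Matrix (Fin 3) (Fin 3) ℂ}
    (hU : U ∈ Matrix.unitaryGroup (Fin 3) ℂ) : U.transpose ∈ Matrix.unitaryGroup (Fin 3) ℂ := by
  rw [Matrix.mem_unitaryGroup_iff]
  have := congrArg Matrix.transpose (Matrix.mem_unitaryGroup_iff'.1 hU)
  rwa [Matrix.transpose_mul, Matrix.transpose_one] at this

/-- With `X = U Uᵀ`, the CP transformation is plain complex conjugation of the doublets in the basis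
`U`. -/
theorem cpTransform_mul_transpose (U : Matrix (Fin 3) (Fin 3) ℂ) (h : Doublets) :
    cpTransform (U * U.transpose) h = act U (star (act (star U) h)) := by
  have hU : (star U).map star = U.transpose := by
    ext a b
    simp [Matrix.star_apply]
  rw [cpTransform_eq_act, star_act, act_act, hU]

theorem act_act_star {U : Matrix (Fin 3) (Fin 3) ℂ} (hU : U ∈ Matrix.unitaryGroup (Fin 3) ℂ)
    (h : Doublets) : act U (act (star U) h) = h := by
  rw [act_act, Matrix.mem_unitaryGroup_iff.1 hU, act_one]

theorem V4_invariant_of_real {p : Couplings} {U : Matrix (Fin 3) (Fin 3) ℂ}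
    (hU : U ∈ Matrix.unitaryGroup (Fin 3) ℂ)
    (hZ : ∀ a b c d, (changeZ U (tensorZ p) a b c d).im = 0) (h : Doublets) :
    V4 p (cpTransform (U * U.transpose) h) = V4 p h := by
  rw [V4_eq_quartic, V4_eq_quartic, cpTransform_mul_transpose, quartic_act,
    quartic_star_of_real hZ, ← quartic_act, act_act_star hU, star_quartic_tensorZ]

theorem V2_invariant_of_real {p : Couplings} {U : Matrix (Fin 3) (Fin 3) ℂ}
    (hU : U ∈ Matrix.unitaryGroup (Fin 3) ℂ)
    (hY : ∀ a b, (changeY U (tensorY p) a b).im = 0) (h : Doublets) :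
    V2 p (cpTransform (U * U.transpose) h) = V2 p h := by
  rw [V2_eq_quadratic, V2_eq_quadratic, cpTransform_mul_transpose, quadratic_act,
    quadratic_star_of_real hY, ← quadratic_act, act_act_star hU, star_quadratic_tensorY]

theorem conservesCP_V4_of_realBasis {p : Couplings} (hp : HasRealBasisZ (tensorZ p)) :
    ExplicitlyConservesCP (V4 p) := by
  obtain ⟨U, hU, hZ⟩ := hp
  exact ⟨U * U.transpose, mul_mem hU (transpose_mem_unitaryGroup hU), V4_invariant_of_real hU hZ⟩

theorem conservesCP_V_of_realBasis {p : Couplings}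
    (hp : HasRealBasisYZ (tensorY p) (tensorZ p)) : ExplicitlyConservesCP (V p) := by
  obtain ⟨U, hU, hY, hZ⟩ := hp
  refine ⟨U * U.transpose, mul_mem hU (transpose_mem_unitaryGroup hU), fun h => ?_⟩
  simp only [V, V2_invariant_of_real hU hY, V4_invariant_of_real hU hZ]

/-! ### Particular changes of basis -/

theorem changeZ_changeZ {Z : Tensor4} (hZ : PairSymm Z) (U W : Matrix (Fin 3) (Fin 3) ℂ) :
    changeZ U (changeZ W Z) = changeZ (W * U) Z := by
  refine quartic_injective ((hZ.changeZ W).changeZ U) (hZ.changeZ _) fun h => ?_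
  rw [← quartic_act, ← quartic_act, ← quartic_act, act_act]

theorem changeY_changeY (Y : Tensor2) (U W : Matrix (Fin 3) (Fin 3) ℂ) :
    changeY U (changeY W Y) = changeY (W * U) Y := by
  refine quadratic_injective fun h => ?_
  rw [← quadratic_act, ← quadratic_act, ← quadratic_act, act_act]

theorem HasRealBasisZ.of_changeZ {Z : Tensor4} (hZ : PairSymm Z) {W : Matrix (Fin 3) (Fin 3) ℂ}
    (hW : W ∈ Matrix.unitaryGroup (Fin 3) ℂ) (h : HasRealBasisZ (changeZ W Z)) :
    HasRealBasisZ Z := by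
  obtain ⟨U, hU, hr⟩ := h
  rw [changeZ_changeZ hZ] at hr
  exact ⟨W * U, mul_mem hW hU, hr⟩

theorem HasRealBasisYZ.of_change {Y : Tensor2} {Z : Tensor4} (hZ : PairSymm Z)
    {W : Matrix (Fin 3) (Fin 3) ℂ} (hW : W ∈ Matrix.unitaryGroup (Fin 3) ℂ)
    (h : HasRealBasisYZ (changeY W Y) (changeZ W Z)) : HasRealBasisYZ Y Z := by
  obtain ⟨U, hU, hrY, hrZ⟩ := h
  rw [changeZ_changeZ hZ] at hrZ
  rw [changeY_changeY] at hrY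
  exact ⟨W * U, mul_mem hW hU, hrY, hrZ⟩

/-- The rephasing `h_S = w h'_S`. -/
def phaseMatrix (w : ℂ) : Matrix (Fin 3) (Fin 3) ℂ := !![1, 0, 0; 0, 1, 0; 0, 0, w]

theorem phaseMatrix_mem {w : ℂ} (hw : w * star w = 1) :
    phaseMatrix w ∈ Matrix.unitaryGroup (Fin 3) ℂ := by
  rw [Matrix.mem_unitaryGroup_iff]
  ext i j
  fin_cases i <;> fin_cases j <;> simp [phaseMatrix, Matrix.mul_apply, Fin.sum_univ_three]
  exact hw

/-- The couplings after the rephasing `h_S = w h'_S`. -/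
def Couplings.rephase (p : Couplings) (w : ℂ) : Couplings :=
  { p with l4 := p.l4 * star w, l7 := p.l7 * star w ^ 2 }

theorem act_phaseMatrix (w : ℂ) (h : Doublets) :
    act (phaseMatrix w) h = ![h 0, h 1, fun i => w * h 2 i] := by
  funext a i
  fin_cases a <;> simp [act, phaseMatrix, Fin.sum_univ_three]

theorem V4_rephase (p : Couplings) {w : ℂ} (hw : w * star w = 1) (h : Doublets) :
    V4 p (act (phaseMatrix w) h) = V4 (p.rephase w) h := by
  have b00 : bil (act (phaseMatrix w) h) 0 0 = bil h 0 0 := by rw [act_phaseMatrix]; rfl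
  have b01 : bil (act (phaseMatrix w) h) 0 1 = bil h 0 1 := by rw [act_phaseMatrix]; rfl
  have b10 : bil (act (phaseMatrix w) h) 1 0 = bil h 1 0 := by rw [act_phaseMatrix]; rfl
  have b11 : bil (act (phaseMatrix w) h) 1 1 = bil h 1 1 := by rw [act_phaseMatrix]; rfl
  have b20 : bil (act (phaseMatrix w) h) 2 0 = star w * bil h 2 0 := by
    rw [act_phaseMatrix]; simp [bil, mul_add, mul_assoc]
  have b21 : bil (act (phaseMatrix w) h) 2 1 = star w * bil h 2 1 := by
    rw [act_phaseMatrix]; simp [bil, mul_add, mul_assoc]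
  have b02 : bil (act (phaseMatrix w) h) 0 2 = w * bil h 0 2 := by
    rw [act_phaseMatrix]; simp [bil, mul_add, mul_left_comm]
  have b12 : bil (act (phaseMatrix w) h) 1 2 = w * bil h 1 2 := by
    rw [act_phaseMatrix]; simp [bil, mul_add, mul_left_comm]
  have b22 : bil (act (phaseMatrix w) h) 2 2 = bil h 2 2 := by
    have : bil (act (phaseMatrix w) h) 2 2 = w * star w * bil h 2 2 := by
      rw [act_phaseMatrix]; simp [bil, mul_add]; ring
    rw [this, hw, one_mul]
  simp only [V4, addHC, b00, b01, b10, b11, b20, b21, b02, b12, b22, star_mul', star_add, star_sub,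
    star_pow, star_star, star_bil, Couplings.rephase]
  linear_combination p.l6 * (bil h 2 0 * bil h 0 2 + bil h 2 1 * bil h 1 2) * hw

theorem changeZ_phaseMatrix (p : Couplings) {w : ℂ} (hw : w * star w = 1) :
    changeZ (phaseMatrix w) (tensorZ p) = tensorZ (p.rephase w) := by
  refine quartic_injective ((tensorZ_pairSymm p).changeZ _) (tensorZ_pairSymm _) fun h => ?_
  have := V4_rephase p hw h
  rw [V4_eq_quartic, V4_eq_quartic] at this
  rw [← quartic_act]
  linear_combination 2 * this

theorem changeY_phaseMatrix (p : Couplings) {w : ℂ} (hw : w * star w = 1) :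
    changeY (phaseMatrix w) (tensorY p) = tensorY (p.rephase w) := by
  funext a b
  fin_cases a <;> fin_cases b <;>
    simp [changeY, phaseMatrix, tensorY, Fin.sum_univ_three, Couplings.rephase]
  rw [← starRingEnd_apply] at hw
  linear_combination (p.mu0sq : ℂ) * hw

/-- The basis change `h₁ = i (h₊ - h₋) / √2`, `h₂ = (h₊ + h₋) / √2`, where `s = 1 / √2`. -/
def chargedMatrix (s : ℝ) : Matrix (Fin 3) (Fin 3) ℂ :=
  !![s * Complex.I, -(s * Complex.I), 0; s, s, 0; 0, 0, 1]

theorem chargedMatrix_mem {s : ℝ} (hs : s ^ 2 = 1 / 2) :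
    chargedMatrix s ∈ Matrix.unitaryGroup (Fin 3) ℂ := by
  have hs' : (s : ℂ) ^ 2 = 1 / 2 := by rw [← Complex.ofReal_pow, hs]; norm_num
  rw [Matrix.mem_unitaryGroup_iff]
  ext i j
  fin_cases i <;> fin_cases j <;>
    simp [chargedMatrix, Matrix.mul_apply, Fin.sum_univ_three]
  · linear_combination 2 * hs' - 2 * s ^ 2 * Complex.I_sq
  · linear_combination 2 * hs'

theorem quartic_tensorZ_charged (p : Couplings) {s : ℝ} (hs : s ^ 2 = 1 / 2) (h : Doublets) :
    quartic (tensorZ p) (act (chargedMatrix s) h) =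
      quartic (chargedZ (2 * p.l1 - 2 * p.l2) (2 * p.l1 + 2 * p.l2) (4 * p.l3) p.l5 p.l6 (2 * p.l8)
        (2 * p.l7) (2 * star p.l7) (-(2 * s * p.l4)) (-(2 * s * star p.l4))) h := by
  have hs' : (s : ℂ) ^ 2 = 1 / 2 := by rw [← Complex.ofReal_pow, hs]; norm_num
  have hI := Complex.I_sq
  have b00 : bil (act (chargedMatrix s) h) 0 0 =
      1 / 2 * (bil h 0 0 - bil h 0 1 - bil h 1 0 + bil h 1 1) := by
    simp [bil_act, chargedMatrix, Fin.sum_univ_three]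
    linear_combination (-(Complex.I ^ 2) * (bil h 0 0 - bil h 0 1 - bil h 1 0 + bil h 1 1)) * hs' - (bil h 0 0 - bil h 0 1 - bil h 1 0 + bil h 1 1) / 2 * hI
  have b01 : bil (act (chargedMatrix s) h) 0 1 =
      -Complex.I / 2 * (bil h 0 0 + bil h 0 1 - bil h 1 0 - bil h 1 1) := by
    simp [bil_act, chargedMatrix, Fin.sum_univ_three]
    linear_combination (-Complex.I * (bil h 0 0 + bil h 0 1 - bil h 1 0 - bil h 1 1)) * hs'
  have b10 : bil (act (chargedMatrix s) h) 1 0 =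
      Complex.I / 2 * (bil h 0 0 - bil h 0 1 + bil h 1 0 - bil h 1 1) := by
    simp [bil_act, chargedMatrix, Fin.sum_univ_three]
    linear_combination (Complex.I * (bil h 0 0 - bil h 0 1 + bil h 1 0 - bil h 1 1)) * hs'
  have b11 : bil (act (chargedMatrix s) h) 1 1 =
      1 / 2 * (bil h 0 0 + bil h 0 1 + bil h 1 0 + bil h 1 1) := by
    simp [bil_act, chargedMatrix, Fin.sum_univ_three]
    linear_combination (bil h 0 0 + bil h 0 1 + bil h 1 0 + bil h 1 1) * hs'
  have b20 : bil (act (chargedMatrix s) h) 2 0 = s * Complex.I * (bil h 2 0 - bil h 2 1) := by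
    simp [bil_act, chargedMatrix, Fin.sum_univ_three]
    ring
  have b21 : bil (act (chargedMatrix s) h) 2 1 = s * (bil h 2 0 + bil h 2 1) := by
    simp [bil_act, chargedMatrix, Fin.sum_univ_three]
    ring
  have b02 : bil (act (chargedMatrix s) h) 0 2 = -(s * Complex.I) * (bil h 0 2 - bil h 1 2) := by
    simp [bil_act, chargedMatrix, Fin.sum_univ_three]
    ring
  have b12 : bil (act (chargedMatrix s) h) 1 2 = s * (bil h 0 2 + bil h 1 2) := by
    simp [bil_act, chargedMatrix, Fin.sum_univ_three]
    ring
  have b22 : bil (act (chargedMatrix s) h) 2 2 = bil h 2 2 := by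
    simp [bil_act, chargedMatrix, Fin.sum_univ_three]
  have hV := V4_eq_quartic p (act (chargedMatrix s) h)
  rw [show quartic (tensorZ p) (act (chargedMatrix s) h) = 2 * V4 p (act (chargedMatrix s) h) by
    rw [hV]; ring]
  simp only [V4, addHC, star_mul', star_add, star_sub, star_bil, quartic]
  simp only [b00, b01, b10, b11, b20, b21, b02, b12, b22]
  generalize bil h = K
  simp only [Fin.sum_univ_three, chargedZ, Fin.isValue, Matrix.of_apply, Matrix.cons_val_zero,
    Matrix.cons_val_one, Matrix.cons_val, zero_mul, add_zero, zero_add]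
  generalize star p.l4 = c4
  generalize star p.l7 = c7
  ring_nf
  simp only [hs', hI]
  ring_nf

/-- A circulant unitary matrix which permutes the quartic forms invariant under the
Heisenberg group of `ℤ/3`. -/
noncomputable def circulantMatrix (ω : ℂ) : Matrix (Fin 3) (Fin 3) ℂ :=
  let u := (1 + 2 * ω) / 3
  let v := (1 - ω) / 3
  !![u, v, v; v, u, v; v, v, u]

/-- The matrix has eigenvalue `1` on `(1, 1, 1)` and `ω` on its orthogonal complement; the
hypotheses make `ω` a primitive cube root of unity. -/
theorem circulantMatrix_mem {ω : ℂ} (hω : ω ^ 2 = -1 - ω) (hs : star ω = -1 - ω) :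
    circulantMatrix ω ∈ Matrix.unitaryGroup (Fin 3) ℂ := by
  have hs' : (starRingEnd ℂ) ω = -1 - ω := hs
  rw [Matrix.mem_unitaryGroup_iff]
  ext i j
  fin_cases i <;> fin_cases j <;>
    simp [circulantMatrix, Matrix.mul_apply, Fin.sum_univ_three, hs', Complex.conj_ofNat] <;> ring_nf <;>
    simp only [hω] <;> ring

theorem bil_circulantMatrix {ω : ℂ} (hω : ω ^ 2 = -1 - ω) (hs : star ω = -1 - ω) (h : Doublets)
    (i j k : Fin 3) (hijk : [i, j, k].Nodup) :
    3 * bil (act (circulantMatrix ω) h) i i = bil h i i + bil h j j + bil h k k + bil h j k + bil h k j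
      + (-1 - ω) * (bil h i j + bil h i k) + ω * (bil h j i + bil h k i) ∧
    3 * bil (act (circulantMatrix ω) h) i j = bil h i j + bil h k i + bil h j i + bil h k k + bil h j k
      + (-1 - ω) * (bil h i i + bil h i k) + ω * (bil h j j + bil h k j) := by
  have hs' : (starRingEnd ℂ) ω = -1 - ω := hs
  fin_cases i <;> fin_cases j <;> fin_cases k <;> simp at hijk <;>
    simp [bil_act, circulantMatrix, Fin.sum_univ_three, hs', Complex.conj_ofNat] <;> constructor <;> ring_nf <;>
    simp only [hω] <;> ring

/-- The quartic tensor with all parameters real which the circulant basis change produces. -/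
noncomputable def realZ (b c x q : ℂ) : Tensor4 :=
  chargedZ (b + c - 2 * q) (b - 2 * x + q) (c - 2 * x + q) (b - 2 * x + q) (c - 2 * x + q)
    (b + c - 2 * q) (2 * x + q) (2 * x + q) (2 * x + q) (2 * x + q)

-- Taking `d = b`, `e = c`, `f = a`, `y = g'` and `y' = g` makes the charged tensor invariant under
-- cyclic permutations of the doublets. Tying `G` and `G'` to the same `x` as `a = b + c - 4x` makes
-- `ω` drop out of the transformed tensor.
set_option maxRecDepth 20000 in
set_option maxHeartbeats 2000000 in
theorem quartic_circulantMatrix {ω : ℂ} (hω : ω ^ 2 = -1 - ω) (hs : star ω = -1 - ω)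
    (b c x q : ℂ) (h : Doublets) {G G' : ℂ} (hG : G = (-2 * x + q * (1 + 2 * ω)) * (-1 - ω))
    (hG' : G' = (-2 * x - q * (1 + 2 * ω)) * ω) :
    quartic (chargedZ (b + c - 4 * x) b c b c (b + c - 4 * x) G' G G G')
      (act (circulantMatrix ω) h) = quartic (realZ b c x q) h := by
  have hω3 : ω ^ 3 = 1 := by linear_combination (ω - 1) * hω
  have hω4 : ω ^ 4 = ω := by linear_combination ω * hω3
  have b0 := bil_circulantMatrix hω hs h 0 1 2 (by decide)
  have b0' := bil_circulantMatrix hω hs h 0 2 1 (by decide)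
  have b1 := bil_circulantMatrix hω hs h 1 2 0 (by decide)
  have b1' := bil_circulantMatrix hω hs h 1 0 2 (by decide)
  have b2 := bil_circulantMatrix hω hs h 2 0 1 (by decide)
  have b2' := bil_circulantMatrix hω hs h 2 1 0 (by decide)
  -- Each of the two bilinears in a quartic term has denominator `3` in the new basis.
  refine mul_left_cancel₀ (by norm_num : (9 : ℂ) ≠ 0) ?_
  subst hG hG'
  simp only [quartic, realZ]
  generalize bil (act (circulantMatrix ω) h) = L at *
  generalize bil h = K at *
  simp only [Fin.sum_univ_three, chargedZ, Fin.isValue, Matrix.of_apply, Matrix.cons_val_zero,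
    Matrix.cons_val_one, Matrix.cons_val, zero_mul, add_zero, zero_add]
  have solve : ∀ {m n : ℂ}, 3 * m = n → m = n / 3 := fun h => by rw [← h]; ring
  rw [solve b0.1, solve b1.1, solve b2.1, solve b0.2, solve b0'.2, solve b1.2, solve b1'.2,
    solve b2.2, solve b2'.2]
  ring_nf
  simp only [hω, hω3, hω4]
  ring_nf

/-! ### Real bases for the CP-conserving couplings -/

theorem chargedZ_pairSymm (a b c d e f g g' y y' : ℂ) :
    PairSymm (chargedZ a b c d e f g g' y y') := by
  intro i j k l
  fin_cases i <;> fin_cases j <;> fin_cases k <;> fin_cases l <;> rfl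

theorem changeZ_one (Z : Tensor4) : changeZ 1 Z = Z := by
  funext a b c d
  simp [changeZ, Matrix.one_apply, apply_ite]

theorem changeY_one (Y : Tensor2) : changeY 1 Y = Y := by
  funext a b
  simp [changeY, Matrix.one_apply, apply_ite]

theorem tensorZ_im {p : Couplings} (h4 : p.l4.im = 0) (h7 : p.l7.im = 0) (a b c d : Fin 3) :
    (tensorZ p a b c d).im = 0 := by
  have e1 : (2 * p.l1 + 2 * p.l3 : ℂ).im = 0 := by simp
  have e2 : (2 * p.l1 - 2 * p.l3 : ℂ).im = 0 := by simp
  have e3 : (2 * p.l2 + 2 * p.l3 : ℂ).im = 0 := by simp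
  have e4 : (-2 * p.l2 + 2 * p.l3 : ℂ).im = 0 := by simp
  have e5 : (2 * p.l8 : ℂ).im = 0 := by simp
  have e6 : (star p.l4).im = 0 := by simp [h4]
  have e7 : (2 * star p.l7).im = 0 := by simp [h7]
  have e8 : (2 * p.l7).im = 0 := by simp [h7]
  have e9 : (-p.l4).im = 0 := by simp [h4]
  have e10 : (-star p.l4).im = 0 := by simp [h4]
  fin_cases a <;> fin_cases b <;> fin_cases c <;> fin_cases d <;>
    first
    | exact Complex.zero_im | exact e1 | exact e2 | exact e3 | exact e4 | exact e5 | exact h4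
    | exact e6 | exact e7 | exact e8 | exact e9 | exact e10

theorem tensorY_im (p : Couplings) (a b : Fin 3) : (tensorY p a b).im = 0 := by
  fin_cases a <;> fin_cases b <;> exact Complex.ofReal_im _

theorem realZ_im (b c x q : ℝ) (i j k l : Fin 3) : (realZ b c x q i j k l).im = 0 := by
  have e1 : (b + c - 2 * q : ℂ).im = 0 := by simp
  have e2 : (b - 2 * x + q : ℂ).im = 0 := by simp
  have e3 : (c - 2 * x + q : ℂ).im = 0 := by simp
  have e4 : (2 * x + q : ℂ).im = 0 := by simp
  fin_cases i <;> fin_cases j <;> fin_cases k <;> fin_cases l <;>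
    first
    | exact Complex.zero_im | exact e1 | exact e2 | exact e3 | exact e4

theorem hasRealBasisYZ_of_rephase {p : Couplings} {w : ℂ} (hw : w * star w = 1)
    (h4 : (p.l4 * star w).im = 0) (h7 : (p.l7 * star w ^ 2).im = 0) :
    HasRealBasisYZ (tensorY p) (tensorZ p) := by
  refine HasRealBasisYZ.of_change (tensorZ_pairSymm p) (phaseMatrix_mem hw) ?_
  rw [changeY_phaseMatrix p hw, changeZ_phaseMatrix p hw]
  refine ⟨1, one_mem _, fun a b => ?_, fun a b c d => ?_⟩
  · rw [changeY_one]
    exact tensorY_im _ a b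
  · rw [changeZ_one]
    exact tensorZ_im (p := p.rephase w) h4 h7 a b c d

theorem HasRealBasisYZ.toZ {Y : Tensor2} {Z : Tensor4} (h : HasRealBasisYZ Y Z) :
    HasRealBasisZ Z := by
  obtain ⟨U, hU, -, hZ⟩ := h
  exact ⟨U, hU, hZ⟩

theorem exists_phase (z : ℂ) : ∃ w : ℂ, w * star w = 1 ∧ (z * star w).im = 0 := by
  by_cases hz : z = 0
  · exact ⟨1, by simp, by simp [hz]⟩
  have hn : (‖z‖ : ℂ) ≠ 0 := by simpa using hz
  have hzz : z * star z = (‖z‖ : ℂ) ^ 2 := Complex.mul_conj' z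
  have hs : star (z / ‖z‖) = star z / ‖z‖ := by simp
  refine ⟨z / ‖z‖, ?_, ?_⟩
  · rw [hs, div_mul_div_comm, hzz]
    field_simp
  · rw [hs, mul_div_assoc', hzz, sq, mul_div_assoc, div_self hn, mul_one]
    exact Complex.ofReal_im _

theorem hasRealBasisYZ_of_l4_im {p : Couplings} (h7 : p.l7.im = 0) (h4 : p.l4.im = 0) :
    HasRealBasisYZ (tensorY p) (tensorZ p) :=
  hasRealBasisYZ_of_rephase (w := 1) (by simp) (by simpa using h4) (by simpa using h7)

theorem hasRealBasisYZ_of_l4_re {p : Couplings} (h7 : p.l7.im = 0) (h4 : p.l4.re = 0) :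
    HasRealBasisYZ (tensorY p) (tensorZ p) :=
  hasRealBasisYZ_of_rephase (w := Complex.I) (by simp) (by simpa using h4) (by simp [h7])

theorem hasRealBasisYZ_of_l7 {p : Couplings} (h7 : p.l7 = 0) :
    HasRealBasisYZ (tensorY p) (tensorZ p) := by
  obtain ⟨w, hw, h4⟩ := exists_phase p.l4
  exact hasRealBasisYZ_of_rephase hw h4 (by simp [h7])

theorem changeZ_chargedMatrix (p : Couplings) {s : ℝ} (hs : s ^ 2 = 1 / 2) :
    changeZ (chargedMatrix s) (tensorZ p) =
      chargedZ (2 * p.l1 - 2 * p.l2) (2 * p.l1 + 2 * p.l2) (4 * p.l3) p.l5 p.l6 (2 * p.l8)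
        (2 * p.l7) (2 * star p.l7) (-(2 * s * p.l4)) (-(2 * s * star p.l4)) :=
  quartic_injective ((tensorZ_pairSymm p).changeZ _) (chargedZ_pairSymm _ _ _ _ _ _ _ _ _ _) fun h => by
    rw [← quartic_act, quartic_tensorZ_charged p hs]

theorem hasRealBasisZ_chargedZ (b c x q : ℝ) {ω G G' : ℂ} (hω : ω ^ 2 = -1 - ω)
    (hs : star ω = -1 - ω) (hG : G = (-2 * x + q * (1 + 2 * ω)) * (-1 - ω))
    (hG' : G' = (-2 * x - q * (1 + 2 * ω)) * ω) :
    HasRealBasisZ (chargedZ (b + c - 4 * x) b c b c (b + c - 4 * x) G' G G G') := by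
  refine ⟨circulantMatrix ω, circulantMatrix_mem hω hs, ?_⟩
  have : changeZ (circulantMatrix ω)
      (chargedZ (b + c - 4 * x) b c b c (b + c - 4 * x) G' G G G') = realZ b c x q :=
    quartic_injective ((chargedZ_pairSymm _ _ _ _ _ _ _ _ _ _).changeZ _) (chargedZ_pairSymm _ _ _ _ _ _ _ _ _ _) fun h => by
      rw [← quartic_act, quartic_circulantMatrix hω hs _ _ _ _ h hG hG']
  rw [this]
  exact realZ_im b c x q

/-- The linear relations say that the charged tensor has `d = b`, `e = c`, `f = a`. The quadratic
ones give `|λ₄|² = 2 λ₇²`, so `g` and `y` have equal modulus, and they fix the phase of `λ₄` so that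
one rephasing achieves both `y = g'` and the form of `G` needed for the circulant basis change. -/
theorem realBasis_of_solution3 {p : Couplings} (h7 : p.l7.im = 0) (h : Solution3 p) :
    HasRealBasisZ (tensorZ p) := by
  obtain ⟨hne, hR, hI, h5, h6, h8⟩ := h
  have hkne : p.l7.re ≠ 0 := fun h => hne (by rw [h, mul_zero])
  have hRne : p.l4.re ≠ 0 := fun h => hne (by rw [h, zero_mul, zero_mul])
  have hIne : p.l4.im ≠ 0 := fun h => hne (by rw [h, mul_zero, zero_mul])
  have hl7 : p.l7 = (p.l7.re : ℂ) := Complex.ext (by simp) (by simpa using h7)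
  have hl4 : p.l4 = p.l4.re + p.l4.im * Complex.I := (Complex.re_add_im p.l4).symm
  generalize p.l7.re = k at *
  generalize p.l4.re = R at *
  generalize p.l4.im = J at *
  obtain ⟨x, hx⟩ : ∃ x, x = p.l2 + p.l3 := ⟨_, rfl⟩
  rw [← hx] at hR hI
  have hk1 : 2 * x + k ≠ 0 := fun h => hRne (by rw [h] at hR; simpa using hR)
  have hk2 : 2 * x - k ≠ 0 := fun h => hIne (by rw [h] at hI; simpa using hI)
  obtain ⟨s, hs⟩ : ∃ s : ℝ, s ^ 2 = 1 / 2 := ⟨√(1 / 2), Real.sq_sqrt (by norm_num)⟩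
  obtain ⟨t, ht⟩ : ∃ t : ℝ, t ^ 2 = 3 := ⟨√3, Real.sq_sqrt (by norm_num)⟩
  have htne : t ≠ 0 := fun h => by rw [h] at ht; norm_num at ht
  -- the angle whose double has cosine `x / k`
  obtain ⟨σ, hσ⟩ : ∃ σ, σ = s * R / (2 * x + k) := ⟨_, rfl⟩
  obtain ⟨c, hc⟩ : ∃ c, c = s * J / (2 * x - k) := ⟨_, rfl⟩
  have hσ2 : 2 * k * σ ^ 2 = k - x := by
    rw [hσ, div_pow, mul_pow, hs, hR]
    field_simp
    ring
  have hc2 : 2 * k * c ^ 2 = k + x := by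
    rw [hc, div_pow, mul_pow, hs, hI]
    field_simp
    ring
  have hσc : σ ^ 2 + c ^ 2 = 1 := by
    have : 2 * k * (σ ^ 2 + c ^ 2) = 2 * k * 1 := by linear_combination hσ2 + hc2
    exact mul_left_cancel₀ (mul_ne_zero two_ne_zero hkne) this
  have hR' : R = 2 * s * ((2 * x + k) * σ) := by
    rw [hσ]
    field_simp
    linear_combination -2 * hs
  have hJ' : J = 2 * s * ((2 * x - k) * c) := by
    rw [hc]
    field_simp
    linear_combination -2 * hs
  have hI2 := Complex.I_sq
  have ht' : (t : ℂ) ^ 2 = 3 := by rw [← Complex.ofReal_pow, ht]; norm_num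
  have hs' : (s : ℂ) ^ 2 = 1 / 2 := by rw [← Complex.ofReal_pow, hs]; norm_num
  have hσ2' : 2 * (k : ℂ) * (σ : ℂ) ^ 2 = k - x := by exact_mod_cast congrArg Complex.ofReal hσ2
  have hc2' : 2 * (k : ℂ) * (c : ℂ) ^ 2 = k + x := by exact_mod_cast congrArg Complex.ofReal hc2
  have hσc' : (σ : ℂ) ^ 2 + (c : ℂ) ^ 2 = 1 := by exact_mod_cast congrArg Complex.ofReal hσc
  obtain ⟨ω, hωdef⟩ : ∃ ω : ℂ, ω = -1 / 2 + t / 2 * Complex.I := ⟨_, rfl⟩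
  have hω : ω ^ 2 = -1 - ω := by
    rw [hωdef]
    linear_combination Complex.I ^ 2 / 4 * ht' + 3 / 4 * hI2
  have hsω : star ω = -1 - ω := by
    rw [hωdef]
    simp
    ring
  -- Since `1 + 2ω = i t`, this real `q` makes `q (1 + 2ω)` equal to `4ikcσ`, the imaginary part of
  -- `2k (c + iσ)²`, whose real part is `2x`.
  obtain ⟨q, hq⟩ : ∃ q, q = 4 * k * c * σ / t := ⟨_, rfl⟩
  have hqω : (q : ℂ) * (1 + 2 * ω) = 4 * k * c * σ * Complex.I := by
    have h1 : (t : ℂ) ≠ 0 := by exact_mod_cast htne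
    rw [hq, hωdef]
    push_cast
    field_simp
    ring
  -- The conjugate of `w` squares to `-(c + iσ)² ω`, which is exactly the phase carrying `2 λ₇ = 2k`
  -- to `G'`.
  obtain ⟨w, hw⟩ : ∃ w : ℂ, w = Complex.I * (c - σ * Complex.I) * ω := ⟨_, rfl⟩
  have hsw : star w = -Complex.I * (c + σ * Complex.I) * (-1 - ω) := by
    rw [hw, star_mul', hsω, star_mul']
    simp
  have hww : w * star w = 1 := by
    rw [hsw, hw]
    linear_combination (Complex.I ^ 2 * (c ^ 2 - σ ^ 2 * Complex.I ^ 2)) * hω + hσc' +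
      (σ ^ 2 * (Complex.I ^ 2 - 1) - c ^ 2) * hI2
  refine HasRealBasisZ.of_changeZ (tensorZ_pairSymm p) (phaseMatrix_mem hww) ?_
  rw [changeZ_phaseMatrix p hww]
  refine HasRealBasisZ.of_changeZ (tensorZ_pairSymm _) (chargedMatrix_mem hs) ?_
  rw [changeZ_chargedMatrix _ hs]
  have hx' : (x : ℂ) = p.l2 + p.l3 := by exact_mod_cast congrArg Complex.ofReal hx
  obtain ⟨G, hG⟩ : ∃ G : ℂ, G = (-2 * x + q * (1 + 2 * ω)) * (-1 - ω) := ⟨_, rfl⟩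
  obtain ⟨G', hG'⟩ : ∃ G' : ℂ, G' = (-2 * x - q * (1 + 2 * ω)) * ω := ⟨_, rfl⟩
  have hGG : star G' = G := by
    have h1 : star (-2 * x - q * (1 + 2 * ω) : ℂ) = -2 * x - q * (1 + 2 * star ω) := by simp
    rw [hG', hG, star_mul', h1, hsω]
    ring
  have hGG' : star G = G' := by rw [← hGG, star_star]
  have eg : 2 * (p.l7 * star w ^ 2) = G' := by
    rw [hsw, hl7, hG']
    linear_combination 2 * k * Complex.I ^ 2 * (c + σ * Complex.I) ^ 2 * hω + ω * hqω +
      ω * ((2 * k * c ^ 2 + 4 * k * c * σ * Complex.I + 2 * k * σ ^ 2 * (Complex.I ^ 2 - 1)) * hI2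
        - hc2' + hσ2')
  have ey : -(2 * s * (p.l4 * star w)) = G := by
    rw [hsw, hl4, hR', hJ', hG]
    push_cast
    linear_combination (-1 - ω) * (4 * Complex.I * ((2 * x + k) * σ + Complex.I * ((2 * x - k) * c))
        * (c + σ * Complex.I) * hs' - hqω + (2 * Complex.I * (2 * x - k) * c * σ +
          2 * ((2 * x + k) * σ ^ 2 + (2 * x - k) * c ^ 2)) * hI2 - 4 * x * hσc' - hσ2' + hc2')
  have eg' : 2 * star (p.l7 * star w ^ 2) = G := by
    rw [← hGG, ← eg]
    simp
  have ey' : -(2 * s * star (p.l4 * star w)) = G' := by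
    rw [← hGG', ← ey]
    simp
  have key := hasRealBasisZ_chargedZ (2 * p.l1 + 2 * p.l2) (4 * p.l3) x q hω hsω hG hG'
  have ea : (2 * p.l1 - 2 * p.l2 : ℂ) =
      ((2 * p.l1 + 2 * p.l2 : ℝ) : ℂ) + ((4 * p.l3 : ℝ) : ℂ) - 4 * x := by
    rw [hx']
    push_cast
    ring
  have eb : (2 * p.l1 + 2 * p.l2 : ℂ) = ((2 * p.l1 + 2 * p.l2 : ℝ) : ℂ) := by push_cast; ring
  have ec : (4 * p.l3 : ℂ) = ((4 * p.l3 : ℝ) : ℂ) := by push_cast; ring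
  have ed : (p.l5 : ℂ) = ((2 * p.l1 + 2 * p.l2 : ℝ) : ℂ) := by rw [h5, mul_add]
  have ee : (p.l6 : ℂ) = ((4 * p.l3 : ℝ) : ℂ) := by rw [h6]
  have ef : (2 * p.l8 : ℂ) = 2 * p.l1 - 2 * p.l2 := by rw [h8]; push_cast; ring
  rw [← ea] at key
  change HasRealBasisZ (chargedZ (2 * p.l1 - 2 * p.l2) (2 * p.l1 + 2 * p.l2) (4 * p.l3) p.l5 p.l6
    (2 * p.l8) (2 * (p.l7 * star w ^ 2)) (2 * star (p.l7 * star w ^ 2))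
    (-(2 * s * (p.l4 * star w))) (-(2 * s * star (p.l4 * star w))))
  rwa [eg, eg', ey, ey', ed, ee, ef, eb, ec]

/-! ### The invariants of the potential -/

theorem star_chargedZ (a b c d e f g g' y y' : ℂ) :
    (fun i j k l => star (chargedZ a b c d e f g g' y y' i j k l)) =
      chargedZ (star a) (star b) (star c) (star d) (star e) (star f) (star g) (star g') (star y)
        (star y') := by
  funext i j k l
  fin_cases i <;> fin_cases j <;> fin_cases k <;> fin_cases l <;> first | rfl | exact star_zero ℂ

/-- When the other parameters are real, conjugating a charged tensor just exchanges `y` and `star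
y`, and this reverses the sign of an invariant. Hence the part of its value antisymmetric under this
exchange suffices to compute it. -/
theorem eq_mul_im_of_sub {i r : ℝ} {v v' y : ℂ} (h : i = v.im) (h' : -i = v'.im)
    (hv : v - v' = (y ^ 2 - star y ^ 2) * r) : i = r * (y ^ 2).im := by
  have h1 := congrArg Complex.im hv
  rw [Complex.sub_im, ← h, ← h', Complex.im_mul_ofReal, Complex.sub_im, ← star_pow] at h1
  have h2 : (star (y ^ 2)).im = -(y ^ 2).im := Complex.conj_im _
  rw [h2] at h1
  linarith

theorem I5Z1_chargedZ (a b c d e f g : ℝ) (y : ℂ) :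
    I5Z1 (chargedZ a b c d e f g g y (star y)) =
      2 * g * (a + b - d - f) ^ 2 * (y ^ 2).im := by
  refine eq_mul_im_of_sub (I5Z1_eq_im _) ?_
    ((value5Z1_chargedZ_sub a b c d e f g y (star y)).trans ?_)
  · rw [← I5Z1_eq_im]
    have := congrFun (invariants_star 0 (chargedZ a b c d e f g g y (star y))) 0
    rw [star_chargedZ] at this
    simpa [invariants] using this.symm
  · push_cast
    ring

theorem I5Z2_chargedZ (a b c d e f g : ℝ) (y : ℂ) :
    I5Z2 (chargedZ a b c d e f g g y (star y)) =
      2 * g * (a + c - e - f) ^ 2 * (y ^ 2).im := by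
  refine eq_mul_im_of_sub (I5Z2_eq_im _) ?_
    ((value5Z2_chargedZ_sub a b c d e f g y (star y)).trans ?_)
  · rw [← I5Z2_eq_im]
    have := congrFun (invariants_star 0 (chargedZ a b c d e f g g y (star y))) 1
    rw [star_chargedZ] at this
    simpa [invariants] using this.symm
  · push_cast
    ring

theorem I2Y3Z_chargedZ (a b c d e f g m m' : ℝ) (y : ℂ) :
    I2Y3Z (diagY m m') (chargedZ a b c d e f g g y (star y)) =
      2 * g * (m' - m) ^ 2 * (y ^ 2).im := by
  refine eq_mul_im_of_sub (I2Y3Z_eq_im _ _) ?_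
    ((value2Y3Z_chargedZ_sub a b c d e f g y (star y) m m').trans ?_)
  · rw [← I2Y3Z_eq_im]
    have := congrFun (invariants_star (diagY m m') (chargedZ a b c d e f g g y (star y))) 5
    have hY : (fun i j => star (diagY m m' i j)) = diagY m m' := by
      funext i j
      fin_cases i <;> fin_cases j <;> exact Complex.conj_ofReal _
    rw [star_chargedZ, hY] at this
    simpa [invariants] using this.symm
  · push_cast
    ring

theorem mul_star_eq_ofReal (y : ℂ) : y * star y = ((Complex.normSq y : ℝ) : ℂ) :=
  Complex.mul_conj y

theorem sq_add_star_sq (y : ℂ) : y ^ 2 + star y ^ 2 = ((2 * (y ^ 2).re : ℝ) : ℂ) := by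
  rw [← star_pow]
  exact Complex.add_conj (y ^ 2)

theorem I6Z1_chargedZ (a b c u k N x : ℝ) (y : ℂ) (hN : N = Complex.normSq y / 2)
    (hx : x = (b - a + c) / 4) :
    I6Z1 (chargedZ a b c (b - 2 * u) (c - 2 * u) (a + 2 * u) (2 * k) (2 * k) y (star y)) =
      48 * k * u * (N - 2 * k ^ 2 + 8 * x * u - 6 * u ^ 2) * (y ^ 2).im := by
  have hN' : (N : ℂ) = y * star y / 2 := by rw [mul_star_eq_ofReal, hN]; push_cast; ring
  have hx' : (x : ℂ) = (b - a + c) / 4 := by rw [hx]; push_cast; ring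
  refine eq_mul_im_of_sub (I6Z1_eq_im _) ?_
    ((value6Z1_chargedZ_sub a b c u k y (star y) N x hN' hx').trans ?_)
  · rw [← I6Z1_eq_im]
    have := congrFun (invariants_star 0
      (chargedZ a b c (b - 2 * u) (c - 2 * u) (a + 2 * u) (2 * k) (2 * k) y (star y))) 2
    rw [star_chargedZ] at this
    simpa [invariants] using this.symm
  · push_cast
    ring

theorem I6Z2_chargedZ (a b c u k N x : ℝ) (y : ℂ) (hN : N = Complex.normSq y / 2)
    (hx : x = (b - a + c) / 4) :
    I6Z2 (chargedZ a b c (b - 2 * u) (c - 2 * u) (a + 2 * u) (2 * k) (2 * k) y (star y)) =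
      48 * k * (k * (y ^ 2).re - 4 * N * x + 3 * N * u - 4 * k ^ 2 * x + 4 * k ^ 2 * u + 16 * x ^ 3
        - 40 * x ^ 2 * u + 36 * x * u ^ 2 - 12 * u ^ 3) * (y ^ 2).im := by
  have hN' : (N : ℂ) = y * star y / 2 := by rw [mul_star_eq_ofReal, hN]; push_cast; ring
  have hx' : (x : ℂ) = (b - a + c) / 4 := by rw [hx]; push_cast; ring
  refine eq_mul_im_of_sub (I6Z2_eq_im _) ?_
    ((value6Z2_chargedZ_sub a b c u k y (star y) N x hN' hx').trans ?_)
  · rw [← I6Z2_eq_im]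
    have := congrFun (invariants_star 0
      (chargedZ a b c (b - 2 * u) (c - 2 * u) (a + 2 * u) (2 * k) (2 * k) y (star y))) 3
    rw [star_chargedZ] at this
    simpa [invariants] using this.symm
  · rw [sq_add_star_sq]
    push_cast
    ring

theorem I7Z_chargedZ (a b c u k N x : ℝ) (y : ℂ) (hN : N = Complex.normSq y / 2)
    (hx : x = (b - a + c) / 4) :
    I7Z (chargedZ a b c (b - 2 * u) (c - 2 * u) (a + 2 * u) (2 * k) (2 * k) y (star y)) =
      32 * k * ((N - 2 * k ^ 2) ^ 2 - 2 * N * x * u - 3 * N * u ^ 2 + 4 * k ^ 2 * x * u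
        - 12 * k ^ 2 * u ^ 2 - 8 * x ^ 2 * u ^ 2 + 12 * x * u ^ 3) * (y ^ 2).im := by
  have hN' : (N : ℂ) = y * star y / 2 := by rw [mul_star_eq_ofReal, hN]; push_cast; ring
  have hx' : (x : ℂ) = (b - a + c) / 4 := by rw [hx]; push_cast; ring
  refine eq_mul_im_of_sub (I7Z_eq_im _) ?_
    ((value7Z_chargedZ_sub a b c u k y (star y) N x hN' hx').trans ?_)
  · rw [← I7Z_eq_im]
    have := congrFun (invariants_star 0
      (chargedZ a b c (b - 2 * u) (c - 2 * u) (a + 2 * u) (2 * k) (2 * k) y (star y))) 4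
    rw [star_chargedZ] at this
    simpa [invariants] using this.symm
  · push_cast
    ring

/-- If `u ≠ 0`, then `e1` determines `N`, and `e3` reduces to `(u - 2x)² = k²`. On the two branches
`e2` forces `R = 0` or `J = 0` respectively. With `u = 0`, `e3` gives `N = 2k²` and `e2` gives `R² -
J²`. -/
theorem solve_invariant_equations {R J k N x u : ℝ} (hR : R ≠ 0) (hJ : J ≠ 0) (hk : k ≠ 0)
    (hN : N = R ^ 2 + J ^ 2) (e1 : u * (N - 2 * k ^ 2 + 8 * x * u - 6 * u ^ 2) = 0)
    (e2 : 2 * k * (R ^ 2 - J ^ 2) - 4 * N * x + 3 * N * u - 4 * k ^ 2 * x + 4 * k ^ 2 * u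
      + 16 * x ^ 3 - 40 * x ^ 2 * u + 36 * x * u ^ 2 - 12 * u ^ 3 = 0)
    (e3 : (N - 2 * k ^ 2) ^ 2 - 2 * N * x * u - 3 * N * u ^ 2 + 4 * k ^ 2 * x * u
      - 12 * k ^ 2 * u ^ 2 - 8 * x ^ 2 * u ^ 2 + 12 * x * u ^ 3 = 0) :
    u = 0 ∧ R ^ 2 = -((x - k) * (2 * x + k) ^ 2) / k ∧
      J ^ 2 = (x + k) * (2 * x - k) ^ 2 / k := by
  have hu : u = 0 := by
    by_contra hu
    have hN2 : N = 2 * k ^ 2 - 8 * x * u + 6 * u ^ 2 := by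
      linear_combination (mul_eq_zero.1 e1).resolve_left hu
    have h3 : (u - 2 * x - k) * (u - 2 * x + k) = 0 := by
      have : 18 * u ^ 2 * ((u - 2 * x - k) * (u - 2 * x + k)) = 0 := by
        rw [hN2] at e3
        linear_combination e3
      exact (mul_eq_zero.1 this).resolve_left (by positivity)
    rcases mul_eq_zero.1 h3 with h | h
    · have hu' : u = 2 * x + k := by linear_combination h
      have h5 : k * R ^ 2 = 0 := by
        rw [hN2, hu'] at e2
        rw [hN2, hu'] at hN
        linear_combination (e2 - 2 * k * hN) / 4
      exact mul_ne_zero hk (pow_ne_zero 2 hR) h5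
    · have hu' : u = 2 * x - k := by linear_combination h
      have h5 : k * J ^ 2 = 0 := by
        rw [hN2, hu'] at e2
        rw [hN2, hu'] at hN
        linear_combination (-e2 - 2 * k * hN) / 4
      exact mul_ne_zero hk (pow_ne_zero 2 hJ) h5
  subst hu
  have hN2 : N = 2 * k ^ 2 := by
    have : (N - 2 * k ^ 2) ^ 2 = 0 := by linear_combination e3
    linear_combination pow_eq_zero_iff two_ne_zero |>.1 this
  refine ⟨rfl, ?_, ?_⟩
  · rw [eq_div_iff hk]
    linear_combination e2 / 4 - k / 2 * hN + (x + k / 2) * hN2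
  · rw [eq_div_iff hk]
    linear_combination -e2 / 4 - k / 2 * hN + (k / 2 - x) * hN2

/-! ### The potential with real `λ₇` in the charged basis, and the solutions. -/

theorem changeY_chargedMatrix (p : Couplings) {s : ℝ} (hs : s ^ 2 = 1 / 2) :
    changeY (chargedMatrix s) (tensorY p) = diagY p.mu1sq p.mu0sq := by
  have hs' : (s : ℂ) ^ 2 = 1 / 2 := by rw [← Complex.ofReal_pow, hs]; norm_num
  have hI := Complex.I_sq
  funext a b
  fin_cases a <;> fin_cases b <;>
    simp [changeY, chargedMatrix, tensorY, diagY, Fin.sum_univ_three]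
  all_goals
    ring_nf
    simp only [hs', hI]
    try ring_nf

/-- The invariants of the potential with real `λ₇` are those of its tensors in the charged
basis. -/
theorem invariants_eq_charged {p : Couplings} (h7 : p.l7.im = 0) {s : ℝ} (hs : s ^ 2 = 1 / 2) :
    invariants (tensorY p) (tensorZ p) = invariants (diagY p.mu1sq p.mu0sq)
      (chargedZ ((2 * p.l1 - 2 * p.l2 : ℝ) : ℂ) ((2 * p.l1 + 2 * p.l2 : ℝ) : ℂ)
        ((4 * p.l3 : ℝ) : ℂ) p.l5 p.l6 ((2 * p.l8 : ℝ) : ℂ) ((2 * p.l7.re : ℝ) : ℂ)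
        ((2 * p.l7.re : ℝ) : ℂ) (-(2 * s * p.l4)) (star (-(2 * s * p.l4)))) := by
  have hl7 : p.l7 = (p.l7.re : ℂ) := Complex.ext (by simp) (by simpa using h7)
  have hy : star (-(2 * s * p.l4)) = -(2 * s * star p.l4) := by simp
  have hl7' : star p.l7 = (p.l7.re : ℂ) := by rw [hl7]; simp
  rw [← invariants_change _ _ (chargedMatrix_mem hs), changeY_chargedMatrix p hs,
    changeZ_chargedMatrix p hs, hy, hl7']
  rw [show (2 : ℂ) * p.l7 = 2 * (p.l7.re : ℂ) by rw [← hl7]]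
  push_cast
  rfl

theorem sq_charged {s : ℝ} (hs : s ^ 2 = 1 / 2) (z : ℂ) :
    (-(2 * s * z)) ^ 2 = 2 * z ^ 2 := by
  have hs' : (s : ℂ) ^ 2 = 1 / 2 := by rw [← Complex.ofReal_pow, hs]; norm_num
  linear_combination 4 * z ^ 2 * hs'

theorem sq_charged_im {s : ℝ} (hs : s ^ 2 = 1 / 2) (z : ℂ) :
    ((-(2 * s * z)) ^ 2).im = 4 * z.re * z.im := by
  rw [sq_charged hs]
  simp [sq]
  ring

theorem sq_charged_re {s : ℝ} (hs : s ^ 2 = 1 / 2) (z : ℂ) :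
    ((-(2 * s * z)) ^ 2).re = 2 * (z.re ^ 2 - z.im ^ 2) := by
  rw [sq_charged hs]
  simp [sq]

theorem normSq_charged {s : ℝ} (hs : s ^ 2 = 1 / 2) (z : ℂ) :
    z.re ^ 2 + z.im ^ 2 = Complex.normSq (-(2 * s * z)) / 2 := by
  simp [Complex.normSq_apply]
  linear_combination -2 * (z.re ^ 2 + z.im ^ 2) * hs

theorem solutions_of_invariants {p : Couplings} (h7 : p.l7.im = 0)
    (h : I5Z1 (tensorZ p) = 0 ∧ I5Z2 (tensorZ p) = 0 ∧ I6Z1 (tensorZ p) = 0 ∧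
      I6Z2 (tensorZ p) = 0 ∧ I7Z (tensorZ p) = 0) :
    p.l4.im = 0 ∨ p.l4.re = 0 ∨ p.l7 = 0 ∨ Solution3 p := by
  by_cases hJ : p.l4.im = 0
  · exact Or.inl hJ
  by_cases hR : p.l4.re = 0
  · exact Or.inr (Or.inl hR)
  by_cases hk : p.l7.re = 0
  · exact Or.inr (Or.inr (Or.inl (Complex.ext hk h7)))
  refine Or.inr (Or.inr (Or.inr ?_))
  obtain ⟨s, hs⟩ : ∃ s : ℝ, s ^ 2 = 1 / 2 := ⟨√(1 / 2), Real.sq_sqrt (by norm_num)⟩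
  have hinv := invariants_eq_charged h7 hs
  obtain ⟨h51, h52, h61, h62, h7Z⟩ := h
  have hyne : ((-(2 * s * p.l4)) ^ 2).im ≠ 0 := by
    rw [sq_charged_im hs]
    positivity
  have g51 := (congrFun hinv 0).symm.trans h51
  have g52 := (congrFun hinv 1).symm.trans h52
  have g61 := (congrFun hinv 2).symm.trans h61
  have g62 := (congrFun hinv 3).symm.trans h62
  have g7Z := (congrFun hinv 4).symm.trans h7Z
  replace g51 := (I5Z1_chargedZ ..).symm.trans g51
  replace g52 := (I5Z2_chargedZ ..).symm.trans g52
  have hk2 : 2 * (2 * p.l7.re) ≠ 0 := by positivity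
  have r51 : 4 * p.l1 - p.l5 - 2 * p.l8 = 0 := by
    have := ((mul_eq_zero.1 g51).resolve_right hyne)
    have := pow_eq_zero_iff two_ne_zero |>.1 ((mul_eq_zero.1 this).resolve_left hk2)
    linear_combination this
  have r52 : 2 * p.l1 - 2 * p.l2 + 4 * p.l3 - p.l6 - 2 * p.l8 = 0 := by
    have := ((mul_eq_zero.1 g52).resolve_right hyne)
    have := pow_eq_zero_iff two_ne_zero |>.1 ((mul_eq_zero.1 this).resolve_left hk2)
    linear_combination this
  -- Given `r51` and `r52`, the condition `u = 0` amounts to the three linear relations of Solution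
  -- 3.
  obtain ⟨u, hu⟩ : ∃ u, u = p.l8 - p.l1 + p.l2 := ⟨_, rfl⟩
  have a5 : (p.l5 : ℂ) = ((2 * p.l1 + 2 * p.l2 : ℝ) : ℂ) - 2 * u := by
    rw [← Complex.ofReal_ofNat 2, ← Complex.ofReal_mul, ← Complex.ofReal_sub]
    congr 1
    linear_combination -r51 + 2 * hu
  have a6 : (p.l6 : ℂ) = ((4 * p.l3 : ℝ) : ℂ) - 2 * u := by
    rw [← Complex.ofReal_ofNat 2, ← Complex.ofReal_mul, ← Complex.ofReal_sub]
    congr 1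
    linear_combination -r52 + 2 * hu
  have a8 : ((2 * p.l8 : ℝ) : ℂ) = ((2 * p.l1 - 2 * p.l2 : ℝ) : ℂ) + 2 * u := by
    rw [← Complex.ofReal_ofNat 2, ← Complex.ofReal_mul, ← Complex.ofReal_add]
    congr 1
    linear_combination -2 * hu
  have a7 : ((2 * p.l7.re : ℝ) : ℂ) = 2 * (p.l7.re : ℂ) := by push_cast; rfl
  rw [a5, a6, a7, a8] at g61 g62 g7Z
  have hN := normSq_charged hs p.l4
  have hx : p.l2 + p.l3 = (2 * p.l1 + 2 * p.l2 - (2 * p.l1 - 2 * p.l2) + 4 * p.l3) / 4 := by ring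
  replace g61 := (I6Z1_chargedZ _ _ _ _ _ _ _ _ hN hx).symm.trans g61
  replace g62 := (I6Z2_chargedZ _ _ _ _ _ _ _ _ hN hx).symm.trans g62
  replace g7Z := (I7Z_chargedZ _ _ _ _ _ _ _ _ hN hx).symm.trans g7Z
  rw [sq_charged_re hs] at g62
  have g61' := (mul_eq_zero.1 g61).resolve_right hyne
  have g62' := (mul_eq_zero.1 ((mul_eq_zero.1 g62).resolve_right hyne)).resolve_left
    (by positivity)
  have g7Z' := (mul_eq_zero.1 ((mul_eq_zero.1 g7Z).resolve_right hyne)).resolve_left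
    (by positivity)
  rw [mul_assoc] at g61'
  have g61'' := (mul_eq_zero.1 g61').resolve_left (by positivity)
  obtain ⟨hu0, hR2, hJ2⟩ := solve_invariant_equations hR hJ hk rfl g61''
    (by linear_combination g62') g7Z'
  rw [hu0] at hu
  refine ⟨by positivity, hR2, hJ2, ?_, ?_, ?_⟩
  · linear_combination -r51 + 2 * hu
  · linear_combination -r52 + 2 * hu
  · linear_combination -hu

theorem masses_eq_of_mixed_invariant {p : Couplings} (h7 : p.l7.im = 0)
    (hne : p.l4.re * p.l4.im * p.l7.re ≠ 0) (h : I2Y3Z (tensorY p) (tensorZ p) = 0) :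
    p.mu0sq = p.mu1sq := by
  obtain ⟨s, hs⟩ : ∃ s : ℝ, s ^ 2 = 1 / 2 := ⟨√(1 / 2), Real.sq_sqrt (by norm_num)⟩
  have g := (congrFun (invariants_eq_charged h7 hs) 5).symm.trans h
  replace g := (I2Y3Z_chargedZ ..).symm.trans g
  rw [sq_charged_im hs] at g
  have h1 : 16 * (p.l4.re * p.l4.im * p.l7.re) * (p.mu0sq - p.mu1sq) ^ 2 = 0 := by
    linear_combination g
  have h2 := (mul_eq_zero.1 h1).resolve_left (mul_ne_zero (by norm_num) hne)
  exact sub_eq_zero.1 (pow_eq_zero_iff two_ne_zero |>.1 h2)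

/-- For equal masses `Y` is a multiple of the identity, so it stays real in whatever basis makes `Z`
real. -/
theorem changeY_of_masses_eq {p : Couplings} (hp : p.mu0sq = p.mu1sq)
    {U : Matrix (Fin 3) (Fin 3) ℂ} (hU : U ∈ Matrix.unitaryGroup (Fin 3) ℂ) :
    changeY U (tensorY p) = tensorY p := by
  have h1 : ∀ a b, tensorY p a b = p.mu1sq * (1 : Matrix (Fin 3) (Fin 3) ℂ) a b := fun a b => by
    fin_cases a <;> fin_cases b <;> simp [tensorY, hp]
  have h2 := Matrix.mem_unitaryGroup_iff'.1 hU
  funext a b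
  rw [h1, ← h2]
  simp only [changeY, h1, Matrix.one_apply, Matrix.mul_apply, Matrix.star_apply, mul_ite, mul_one,
    mul_zero, sum_ite_eq, mem_univ, if_true, mul_sum]
  exact sum_congr rfl fun _ _ => by ring

/-- In a basis with real `λ₇`, one of the listed solutions gives a basis with real couplings. -/
theorem realBasisZ_of_solutions {p : Couplings} (h7 : p.l7.im = 0)
    (h : p.l4.im = 0 ∨ p.l4.re = 0 ∨ p.l7 = 0 ∨ Solution3 p) : HasRealBasisZ (tensorZ p) := by
  rcases h with h | h | h | h
  · exact (hasRealBasisYZ_of_l4_im h7 h).toZ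
  · exact (hasRealBasisYZ_of_l4_re h7 h).toZ
  · exact (hasRealBasisYZ_of_l7 h).toZ
  · exact realBasis_of_solution3 h7 h

theorem realBasisYZ_of_solutions {p : Couplings} (h7 : p.l7.im = 0)
    (h : p.l4.im = 0 ∨ p.l4.re = 0 ∨ p.l7 = 0 ∨ (Solution3 p ∧ p.mu0sq = p.mu1sq)) :
    HasRealBasisYZ (tensorY p) (tensorZ p) := by
  rcases h with h | h | h | ⟨h, hm⟩
  · exact hasRealBasisYZ_of_l4_im h7 h
  · exact hasRealBasisYZ_of_l4_re h7 h
  · exact hasRealBasisYZ_of_l7 h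
  · obtain ⟨U, hU, hZ⟩ := realBasis_of_solution3 h7 h
    refine ⟨U, hU, fun a b => ?_, hZ⟩
    rw [changeY_of_masses_eq hm hU]
    exact tensorY_im p a b

theorem mixed_solutions_of_invariants {p : Couplings} (h7 : p.l7.im = 0)
    (h : I5Z1 (tensorZ p) = 0 ∧ I5Z2 (tensorZ p) = 0 ∧ I6Z1 (tensorZ p) = 0 ∧
      I6Z2 (tensorZ p) = 0 ∧ I7Z (tensorZ p) = 0) (hY : I2Y3Z (tensorY p) (tensorZ p) = 0) :
    p.l4.im = 0 ∨ p.l4.re = 0 ∨ p.l7 = 0 ∨ (Solution3 p ∧ p.mu0sq = p.mu1sq) := by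
  rcases solutions_of_invariants h7 h with h | h | h | h
  · exact Or.inl h
  · exact Or.inr (Or.inl h)
  · exact Or.inr (Or.inr (Or.inl h))
  · exact Or.inr (Or.inr (Or.inr ⟨h, masses_eq_of_mixed_invariant h7 h.1 hY⟩))

/-- Rephasing `h_S` by `w` multiplies `λ₇` by the square of `star w`, so a square root of the phase
of `λ₇` is needed. -/
theorem exists_phase_sq (z : ℂ) : ∃ w : ℂ, w * star w = 1 ∧ (z * star w ^ 2).im = 0 := by
  obtain ⟨v, hv, hz⟩ := exists_phase z
  obtain ⟨w, hw⟩ := IsAlgClosed.exists_pow_nat_eq v two_pos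
  refine ⟨w, ?_, by rwa [← star_pow, hw]⟩
  have h1 : Complex.normSq w ^ 2 = 1 := by
    have : ((Complex.normSq w ^ 2 : ℝ) : ℂ) = 1 := by
      rw [← hv, ← hw, Complex.ofReal_pow, ← mul_star_eq_ofReal, star_pow, mul_pow]
    exact_mod_cast this
  have h2 : Complex.normSq w = 1 :=
    (pow_eq_one_iff_of_nonneg (Complex.normSq_nonneg w) two_ne_zero).1 h1
  rw [mul_star_eq_ofReal, h2, Complex.ofReal_one]

/-- Rephasing changes neither the invariants nor the existence of a real basis, so the case of real
`λ₇` suffices. -/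
theorem realBasisZ_of_invariants {p : Couplings}
    (h : I5Z1 (tensorZ p) = 0 ∧ I5Z2 (tensorZ p) = 0 ∧ I6Z1 (tensorZ p) = 0 ∧
      I6Z2 (tensorZ p) = 0 ∧ I7Z (tensorZ p) = 0) : HasRealBasisZ (tensorZ p) := by
  obtain ⟨w, hw, h7⟩ := exists_phase_sq p.l7
  refine HasRealBasisZ.of_changeZ (tensorZ_pairSymm p) (phaseMatrix_mem hw) ?_
  have hinv := invariants_change 0 (tensorZ p) (phaseMatrix_mem hw)
  rw [changeZ_phaseMatrix p hw] at hinv ⊢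
  refine realBasisZ_of_solutions h7 (solutions_of_invariants h7 ?_)
  exact ⟨(congrFun hinv 0).trans h.1, (congrFun hinv 1).trans h.2.1,
    (congrFun hinv 2).trans h.2.2.1, (congrFun hinv 3).trans h.2.2.2.1,
    (congrFun hinv 4).trans h.2.2.2.2⟩

theorem realBasisYZ_of_invariants {p : Couplings}
    (h : I5Z1 (tensorZ p) = 0 ∧ I5Z2 (tensorZ p) = 0 ∧ I6Z1 (tensorZ p) = 0 ∧
      I6Z2 (tensorZ p) = 0 ∧ I7Z (tensorZ p) = 0) (hY : I2Y3Z (tensorY p) (tensorZ p) = 0) :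
    HasRealBasisYZ (tensorY p) (tensorZ p) := by
  obtain ⟨w, hw, h7⟩ := exists_phase_sq p.l7
  refine HasRealBasisYZ.of_change (tensorZ_pairSymm p) (phaseMatrix_mem hw) ?_
  have hinv := invariants_change (tensorY p) (tensorZ p) (phaseMatrix_mem hw)
  rw [changeZ_phaseMatrix p hw, changeY_phaseMatrix p hw] at hinv ⊢
  refine realBasisYZ_of_solutions h7 (mixed_solutions_of_invariants h7 ?_
    ((congrFun hinv 5).trans hY))
  exact ⟨(congrFun hinv 0).trans h.1, (congrFun hinv 1).trans h.2.1,
    (congrFun hinv 2).trans h.2.2.1, (congrFun hinv 3).trans h.2.2.2.1,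
    (congrFun hinv 4).trans h.2.2.2.2⟩

end S3HDM

theorem mainTheorem1 :
    -- the six quantities are invariant under every unitary change of basis, and CP-odd
    (∀ (Y : S3HDM.Tensor2) (Z : S3HDM.Tensor4), ∀ U ∈ Matrix.unitaryGroup (Fin 3) ℂ,
      S3HDM.invariants (S3HDM.changeY U Y) (S3HDM.changeZ U Z) = S3HDM.invariants Y Z) ∧
    (∀ (Y : S3HDM.Tensor2) (Z : S3HDM.Tensor4),
      S3HDM.invariants (fun a b => star (Y a b)) (fun a b c d => star (Z a b c d))
        = -S3HDM.invariants Y Z) ∧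
    ∀ p : S3HDM.Couplings,
      -- the quadrilinear part
      (S3HDM.ExplicitlyConservesCP (S3HDM.V4 p) ↔
        S3HDM.I5Z1 (S3HDM.tensorZ p) = 0 ∧ S3HDM.I5Z2 (S3HDM.tensorZ p) = 0 ∧
        S3HDM.I6Z1 (S3HDM.tensorZ p) = 0 ∧ S3HDM.I6Z2 (S3HDM.tensorZ p) = 0 ∧
        S3HDM.I7Z (S3HDM.tensorZ p) = 0) ∧
      (S3HDM.ExplicitlyConservesCP (S3HDM.V4 p) ↔ S3HDM.HasRealBasisZ (S3HDM.tensorZ p)) ∧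
      -- the full potential
      (S3HDM.ExplicitlyConservesCP (S3HDM.V p) ↔
        S3HDM.I5Z1 (S3HDM.tensorZ p) = 0 ∧ S3HDM.I5Z2 (S3HDM.tensorZ p) = 0 ∧
        S3HDM.I6Z1 (S3HDM.tensorZ p) = 0 ∧ S3HDM.I6Z2 (S3HDM.tensorZ p) = 0 ∧
        S3HDM.I7Z (S3HDM.tensorZ p) = 0 ∧
        S3HDM.I2Y3Z (S3HDM.tensorY p) (S3HDM.tensorZ p) = 0) ∧
      (S3HDM.ExplicitlyConservesCP (S3HDM.V p) ↔
        S3HDM.HasRealBasisYZ (S3HDM.tensorY p) (S3HDM.tensorZ p)) ∧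
      -- the solutions in a basis where `λ₇` is real
      (p.l7.im = 0 →
        (S3HDM.ExplicitlyConservesCP (S3HDM.V4 p) ↔
          p.l4.im = 0 ∨ p.l4.re = 0 ∨ p.l7 = 0 ∨ S3HDM.Solution3 p) ∧
        (S3HDM.ExplicitlyConservesCP (S3HDM.V p) ↔
          p.l4.im = 0 ∨ p.l4.re = 0 ∨ p.l7 = 0 ∨
            (S3HDM.Solution3 p ∧ p.mu0sq = p.mu1sq))) := by
  refine ⟨fun Y Z U hU => S3HDM.invariants_change Y Z hU, S3HDM.invariants_star, fun p => ?_⟩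
  have toInv := fun h => S3HDM.pure_invariants_eq_zero (p := p) h
  have toInvV : S3HDM.ExplicitlyConservesCP (S3HDM.V p) → _ := fun h =>
    And.intro (toInv (S3HDM.conservesCP_V4_of_V h)) (S3HDM.mixed_invariant_eq_zero h)
  have ofReal := fun h => S3HDM.conservesCP_V4_of_realBasis (p := p) h
  have ofRealV := fun h => S3HDM.conservesCP_V_of_realBasis (p := p) h
  refine ⟨⟨toInv, fun h => ofReal (S3HDM.realBasisZ_of_invariants h)⟩,
    ⟨fun h => S3HDM.realBasisZ_of_invariants (toInv h), ofReal⟩,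
    ⟨fun h => ?_, fun ⟨h1, h2, h3, h4, h5, h6⟩ =>
      ofRealV (S3HDM.realBasisYZ_of_invariants ⟨h1, h2, h3, h4, h5⟩ h6)⟩,
    ⟨fun h => S3HDM.realBasisYZ_of_invariants (toInvV h).1 (toInvV h).2, ofRealV⟩, fun h7 =>
    ⟨⟨fun h => S3HDM.solutions_of_invariants h7 (toInv h),
      fun h => ofReal (S3HDM.realBasisZ_of_solutions h7 h)⟩,
      ⟨fun h => S3HDM.mixed_solutions_of_invariants h7 (toInvV h).1 (toInvV h).2,
        fun h => ofRealV (S3HDM.realBasisYZ_of_solutions h7 h)⟩⟩⟩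
  obtain ⟨⟨h1, h2, h3, h4, h5⟩, h6⟩ := toInvV h
  exact ⟨h1, h2, h3, h4, h5, h6⟩
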